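/- **Data model.** Let $\mu_1,\mu_2\in\mathbb R^D$, $\rho=\|\mu_1-\mu_2\|_2$, $\sigma>0$, and let $K=2$ be the number of classes. A graph $G$ on $n$ nodes and node features $X\in\mathbb R^{n\times D}$ are given, with mean-aggregated features $g_i=g_i(X,G)=|\mathcal N(i)|^{-1}\sum_{j\in\mathcal N(i)}X_j$. Node subgroups $V_0$ (the training nodes, $N_0=|V_0|$), $V_1,\dots,V_M$ follow a generalized CSBM-S model: subgroup $V_i$ has intra- and inter-class edge probabilities $p_i,q_i\in[0,1]$, $p_i+q_i>0$, with $p_i+q_i$ the same for all $i$, and homophily ratio $h_i=p_i/(p_i+q_i)$. The two classes are balanced, and the aggregated feature of a node of $V_i$ has law $N\big(\tfrac{p_i\mu_1+q_i\mu_2}{p_i+q_i},\sigma^2I\big)$ in class 1 and $N\big(\tfrac{q_i\mu_1+p_i\mu_2}{p_i+q_i},\sigma^2I\big)$ in class 2. Given $(X,G)$, labels are independent, $y_j\sim\Pr(y\mid g_j)$, where $\Pr(y\mid g_j)$ is the posterior given by Bayes' rule for the subgroup of $j$. **Classifiers.** $\mathcal H$ consists of $h_j=f(g_j;W_1,\dots,W_L)\in\mathbb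 R^K$, where $f$ is an $L$-layer MLP ($L\ge1$, no biases) with ReLU on the hidden layers, fixed layer widths and $\|W_l\|_F\le C$ for all $l$; $b\ge1$ is the largest width of the hidden layers (or any upper bound of these widths). For a margin $\gamma$ the empirical loss on $V_i$ is $\widehat{\mathcal L}^\gamma_i(h)=\frac1{|V_i|}\sum_{j\in V_i}\mathbf 1\{h_j[y_j]\le\gamma+\max_{k\ne y_j}h_j[k]\}$, and $\mathcal L^\gamma_i(h)$ is its expectation over the labels of $V_i$. **Assumptions on a test subgroup** $V_m$, $0<m\le M$. Put $\epsilon_m=\max_{j\in V_m}\min_{i\in V_0}\|g_i-g_j\|_2$, $B_m=\max_{i\in V_0\cup V_m}\|g_i\|_2$, and $$S_m=\frac{K\rho}{\sqrt{2\pi}\,\sigma}\big(\epsilon_m+|h_0-h_m|\,\rho\big).$$ 1. (Equal-sized disjoint near sets.) The sets $\{j\in V_m:\|g_i-g_j\|_2\le\epsilon_m\}$, $i\in V_0$, are pairwise disjoint and have the same positive size. 2. (Concentrated expected loss difference, with $0<\alpha<\frac14$ and a constant $c\ge0$.) If all entries of $W_1,\dots,W_L$ are drawn independently from $N(0,v)$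 with $v=\dfrac{(\gamma/(8\epsilon_m))^{2/L}}{2b\,(\lambda N_0^{-\alpha}+\ln(2bL))}$, $\lambda=N_0^{2\alpha}$, and $T_h=\max_l\|W_l\|_2$ (spectral norms), then $$\Pr\Big(\mathcal L_m^{\gamma/4}(h)-\mathcal L_0^{\gamma/2}(h)>N_0^{-\alpha}+c\,S_m\ \Big|\ T_h^L\epsilon_m>\tfrac\gamma8\Big)\le e^{-N_0^{2\alpha}} .$$ **Theorem.** For all $\mu_1,\mu_2,\sigma,B,c$ there is a constant $A>0$, depending only on these, such that for every architecture (depth $L$, layer widths, $b$), all $\gamma>0$, $C>0$, $0<\alpha<\frac14$ and $\epsilon_0>0$ there is $N_1$ with the following property. For every $G$, $X$, $V_0,\dots,V_M$, $(p_i,q_i)_i$ as above and every $0<m\le M$ such that $N_0\ge N_1$, $B_m\le B$, $\epsilon_m\ge\epsilon_0$ and the two assumptions hold for $V_m$, and for every $\delta\in(0,1)$: with probability at least $1-\delta$ over the training labels $(y_i)_{i\in V_0}$, all classifiers $\tilde h\in\mathcal H$, with parameters $\widetilde W_1,\dots,\widetilde W_L$, satisfy $$\mathcal L^0_m(\tilde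 h)\le\widehat{\mathcal L}^\gamma_0(\tilde h)+A\left(\frac{K\rho}{\sqrt{2\pi}\,\sigma}\big(\epsilon_m+|h_0-h_m|\rho\big)+\frac{b\sum_{l=1}^L\|\widetilde W_l\|_F^2}{(\gamma/8)^{2/L}N_0^{\alpha}}\,\epsilon_m^{2/L}+\mathbf R\right),$$ $$\mathbf R=\frac1{N_0^{1-2\alpha}}+\frac1{N_0^{2\alpha}}\ln\frac{\max\{1,\;LC(2B_m)^{1/L}\gamma^{-1/L}\}}{\delta}.$$ -/

import Mathlib

open MeasureTheory ProbabilityTheory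
open scoped ENNReal NNReal

noncomputable section

namespace SubgroupGNN

/-- Feature space `ℝ^D` with the Euclidean norm. -/
abbrev Feat (D : ℕ) : Type := EuclideanSpace ℝ (Fin D)

/-- The number `K` of classes: the contextual stochastic block model has two classes. -/
abbrev numClasses : ℕ := 2

/-- Labels. -/
abbrev Label : Type := Fin numClasses

/-! ### The generalized CSBM-S data model -/

/-- Intra-class and inter-class edge probabilities `p i`, `q i` of the subgroups: probabilities,
not both zero, with a common value of `p i + q i`. -/
structure IsGeneralizedCSBMS {M : ℕ} (p q : Fin (M + 1) → ℝ) : Prop where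
  p_mem : ∀ i, p i ∈ Set.Icc (0 : ℝ) 1
  q_mem : ∀ i, q i ∈ Set.Icc (0 : ℝ) 1
  pos : ∀ i, 0 < p i + q i
  same_degree : ∀ i j, p i + q i = p j + q j

/-- The homophily ratio of a structural pattern `(p, q)`. -/
def homophily (p q : ℝ) : ℝ := p / (p + q)

/-- Mean of the aggregated feature of a node of class `k` with structural pattern `(p, q)`:
`(p μ₁ + q μ₂) / (p + q)` in the first class, `(q μ₁ + p μ₂) / (p + q)` in the second. -/
def aggMean {D : ℕ} (μ₁ μ₂ : Feat D) (p q : ℝ) (k : Label) : Feat D :=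
  if k = 0 then (p + q)⁻¹ • (p • μ₁ + q • μ₂) else (p + q)⁻¹ • (q • μ₁ + p • μ₂)

/-- Density of the normal distribution `N(m, σ² I)` on `ℝ^D`. -/
def gaussDensity {D : ℕ} (σ : ℝ) (m f : Feat D) : ℝ :=
  (Real.sqrt (2 * Real.pi * σ ^ 2))⁻¹ ^ D * Real.exp (-‖f - m‖ ^ 2 / (2 * σ ^ 2))

/-- Prior probability of a class (balanced classes). -/
def classPrior (_k : Label) : ℝ := 1 / 2

/-- `Pr(y = k ∣ f)` for a node with pattern `(p, q)` and aggregated feature `f` (Bayes' rule). -/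
def classPosterior {D : ℕ} (μ₁ μ₂ : Feat D) (σ p q : ℝ) (f : Feat D) (k : Label) : ℝ :=
  classPrior k * gaussDensity σ (aggMean μ₁ μ₂ p q k) f /
    ∑ l : Label, classPrior l * gaussDensity σ (aggMean μ₁ μ₂ p q l) f

/-- The conditional distribution `Pr(y ∣ f)` as a measure on the labels. -/
def labelDist {D : ℕ} (μ₁ μ₂ : Feat D) (σ p q : ℝ) (f : Feat D) : Measure Label :=
  ∑ k : Label, ENNReal.ofReal (classPosterior μ₁ μ₂ σ p q f k) • Measure.dirac k

/-! ### Aggregation -/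

open Classical in
/-- One-hop mean aggregation `g_i(X, G) = |N(i)|⁻¹ ∑_{j ∈ N(i)} X_j`. -/
def aggregate {n D : ℕ} (G : SimpleGraph (Fin n)) (X : Fin n → Feat D) (i : Fin n) : Feat D :=
  ((Finset.univ.filter fun j => G.Adj i j).card : ℝ)⁻¹ •
    ∑ j ∈ Finset.univ.filter fun j => G.Adj i j, X j

/-! ### The ReLU network -/

/-- Width of layer `l`: the input layer `0` has width `D`, the output layer `L` has one unit per
class, and the hidden layer `l` (`0 < l < L`) has width `w l`. -/
def width (D L : ℕ) (w : ℕ → ℕ) : ℕ → ℕ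
  | 0 => D
  | l + 1 => if l + 1 = L then numClasses else w (l + 1)

theorem width_last (D L : ℕ) [NeZero L] (w : ℕ → ℕ) : width D L w L = numClasses := by
  obtain ⟨l, rfl⟩ := Nat.exists_eq_succ_of_ne_zero (NeZero.ne L)
  simp [width]

/-- The vectorized parameters: one real number per entry of `W_1, …, W_L`. The matrix with index
`l : Fin L` is `W_{l+1}`, mapping layer `l` to layer `l + 1`. -/
abbrev Params (D L : ℕ) (w : ℕ → ℕ) : Type :=
  (Σ l : Fin L, Fin (width D L w (l + 1)) × Fin (width D L w l)) → ℝ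

/-- The weight matrices. -/
def weight {D L : ℕ} {w : ℕ → ℕ} (θ : Params D L w) (l : Fin L) :
    Matrix (Fin (width D L w (l + 1))) (Fin (width D L w l)) ℝ :=
  Matrix.of fun i j => θ ⟨l, i, j⟩

/-- Pre-activations of layer `l`; the input is used as it is, and ReLU acts on hidden layers. -/
def preact {D L : ℕ} {w : ℕ → ℕ} (θ : Params D L w) (x : Feat D) :
    (l : ℕ) → l ≤ L → Fin (width D L w l) → ℝ
  | 0, _ => fun i => x i
  | l + 1, h => Matrix.mulVec (weight θ ⟨l, h⟩) fun j =>
      if l = 0 then preact θ x l (Nat.le_of_succ_le h) j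
      else max (preact θ x l (Nat.le_of_succ_le h) j) 0

/-- Output logits `f(x; W_1, …, W_L) ∈ ℝ^K`. -/
def logits {D L : ℕ} [NeZero L] {w : ℕ → ℕ} (θ : Params D L w) (x : Feat D) (k : Label) : ℝ :=
  preact θ x L le_rfl (Fin.cast (width_last D L w).symm k)

/-- Squared Frobenius norm. -/
def frobSq {m n : ℕ} (W : Matrix (Fin m) (Fin n) ℝ) : ℝ := ∑ i, ∑ j, W i j ^ 2

/-- Spectral norm. -/
def specNorm {m n : ℕ} (W : Matrix (Fin m) (Fin n) ℝ) : ℝ :=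
  ‖(Matrix.toEuclideanLin W).toContinuousLinearMap‖

/-- `T_h`, the largest spectral norm of a layer. -/
def maxSpec {D L : ℕ} {w : ℕ → ℕ} (θ : Params D L w) : ℝ := ⨆ l : Fin L, specNorm (weight θ l)

/-- The distribution of the network with vectorized parameters drawn from `N(0, v I)`. -/
def prior (D L : ℕ) (w : ℕ → ℕ) (v : ℝ) : Measure (Params D L w) :=
  Measure.pi fun _ => gaussianReal 0 v.toNNReal

/-! ### Margin losses on a set `S` of nodes with aggregated features `g` -/

open Classical in
/-- The `0`-`1` margin loss of the logits `z` at the label `y`. -/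
def marginLoss (γ : ℝ) (z : Label → ℝ) (y : Label) : ℝ :=
  if z y ≤ γ + ⨆ k : {k : Label // k ≠ y}, z k then 1 else 0

/-- Empirical margin loss. -/
def empLoss {n D L : ℕ} [NeZero L] {w : ℕ → ℕ} (g : Fin n → Feat D) (S : Finset (Fin n)) (γ : ℝ)
    (θ : Params D L w) (y : S → Label) : ℝ :=
  (S.card : ℝ)⁻¹ * ∑ i : S, marginLoss γ (logits θ (g i)) (y i)

/-- Law of the labels of `S` given the aggregated features: independent,
`y_i ∼ Pr(y ∣ g_i)`, when `S` has the structural pattern `(p, q)`. -/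
def labelLaw {n D : ℕ} (μ₁ μ₂ : Feat D) (σ p q : ℝ) (g : Fin n → Feat D) (S : Finset (Fin n)) :
    Measure (S → Label) :=
  Measure.pi fun i : S => labelDist μ₁ μ₂ σ p q (g i)

/-- Expected margin loss. -/
def expLoss {n D L : ℕ} [NeZero L] {w : ℕ → ℕ} (μ₁ μ₂ : Feat D) (σ p q : ℝ)
    (g : Fin n → Feat D) (S : Finset (Fin n)) (γ : ℝ) (θ : Params D L w) : ℝ :=
  ∫ y, empLoss g S γ θ y ∂labelLaw μ₁ μ₂ σ p q g S

/-! ### Geometry of a test subgroup `V` relative to the training nodes `V₀` -/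

/-- `ε = max_{j ∈ V} min_{i ∈ V₀} ‖g_i - g_j‖`. -/
def featDist {n D : ℕ} (g : Fin n → Feat D) (V₀ V : Finset (Fin n)) : ℝ :=
  ⨆ j : V, ⨅ i : V₀, ‖g i - g j‖

open Classical in
/-- The near set of the training node `i` with respect to `V`. -/
def nearSet {n D : ℕ} (g : Fin n → Feat D) (V₀ V : Finset (Fin n)) (i : Fin n) :
    Finset (Fin n) :=
  V.filter fun j => ‖g i - g j‖ ≤ featDist g V₀ V

/-- The near sets of the training nodes are disjoint and have the same positive size. -/
def EqualDisjointNearSets {n D : ℕ} (g : Fin n → Feat D) (V₀ V : Finset (Fin n)) : Prop :=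
  (∀ i ∈ V₀, ∀ j ∈ V₀, i ≠ j → Disjoint (nearSet g V₀ V i) (nearSet g V₀ V j)) ∧
    ∃ s : ℕ, 0 < s ∧ ∀ i ∈ V₀, (nearSet g V₀ V i).card = s

/-- `B = max_{i ∈ V₀ ∪ V} ‖g_i‖`. -/
def maxNorm {n D : ℕ} (g : Fin n → Feat D) (V₀ V : Finset (Fin n)) : ℝ :=
  ⨆ i : {i : Fin n // i ∈ V₀ ∨ i ∈ V}, ‖g i‖

/-- `(K ρ / (√(2π) σ)) (ε + Δ ρ)`, where `ρ = ‖μ₁ - μ₂‖`, `ε` is a feature distance and `Δ` a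
difference of homophily ratios. -/
def shiftTerm {D : ℕ} (μ₁ μ₂ : Feat D) (σ ε Δ : ℝ) : ℝ :=
  (numClasses : ℝ) * ‖μ₁ - μ₂‖ / (Real.sqrt (2 * Real.pi) * σ) * (ε + Δ * ‖μ₁ - μ₂‖)

/-- `(γ / (8 ε))^{2/L} / (2 b (λ N^{-α} + ln (2 b L)))` with `λ = N^{2α}`. -/
def priorVar (L b : ℕ) (γ ε α : ℝ) (N : ℕ) : ℝ :=
  (γ / (8 * ε)) ^ (2 / (L : ℝ)) /
    (2 * b * ((N : ℝ) ^ (2 * α) * (N : ℝ) ^ (-α) + Real.log (2 * b * L)))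

/-- Concentrated expected loss difference: for `h` drawn from the Gaussian prior and conditionally
on `T_h^L ε > γ/8`, the expected `γ/4`-loss on `V` exceeds the expected `γ/2`-loss on `V₀` by more
than `N₀^{-α} + c (K ρ / (√(2π) σ)) (ε + |h₀ - h_V| ρ)` with probability at most
`exp (-N₀^{2α})`. -/
def ConcentratedLossDiff {n D : ℕ} (L : ℕ) [NeZero L] (w : ℕ → ℕ) (b : ℕ)
    (μ₁ μ₂ : Feat D) (σ c γ α : ℝ) (g : Fin n → Feat D)
    (V₀ V : Finset (Fin n)) (p₀ q₀ p q : ℝ) : Prop :=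
  (prior D L w (priorVar L b γ (featDist g V₀ V) α V₀.card))[
      {θ | expLoss μ₁ μ₂ σ p q g V (γ / 4) θ - expLoss μ₁ μ₂ σ p₀ q₀ g V₀ (γ / 2) θ >
        (V₀.card : ℝ) ^ (-α) +
          c * shiftTerm μ₁ μ₂ σ (featDist g V₀ V) |homophily p₀ q₀ - homophily p q|} |
      {θ | maxSpec θ ^ L * featDist g V₀ V > γ / 8}]
    ≤ ENNReal.ofReal (Real.exp (-(V₀.card : ℝ) ^ (2 * α)))

/-- `(b ∑_l ‖W_l‖_F² / ((γ/8)^{2/L} N^α)) ε^{2/L}`. -/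
def normTerm {D L : ℕ} {w : ℕ → ℕ} (b : ℕ) (γ α ε : ℝ) (N : ℕ) (θ : Params D L w) : ℝ :=
  b * (∑ l : Fin L, frobSq (weight θ l)) / ((γ / 8) ^ (2 / (L : ℝ)) * (N : ℝ) ^ α) *
    ε ^ (2 / (L : ℝ))

/-- `N^{-(1-2α)} + N^{-2α} ln (max (1, L C (2B)^{1/L} / γ^{1/L}) / δ)`. -/
def remainder (L : ℕ) (γ α C B δ : ℝ) (N : ℕ) : ℝ :=
  1 / (N : ℝ) ^ (1 - 2 * α) + 1 / (N : ℝ) ^ (2 * α) *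
    Real.log (max 1 (L * C * (2 * B) ^ (1 / (L : ℝ)) / γ ^ (1 / (L : ℝ))) / δ)

end SubgroupGNN

end

/-!
The empirical loss depends on the parameters only up to a finite net: by compactness, finitely many
networks approximate the logits of all admissible ones on the bounded features. Hoeffding's
inequality and a union bound over the net therefore control the loss on the training nodes, the
margin absorbing the approximation error.

For the test subgroup there are two cases. If the spectral norms are small, the logits vary by less
than the margin within a near set, and the expected losses are compared node by node, the posterior
being a logistic function of the feature. If they are large, the concentration assumption bounds the
prior mass of the bad networks by `exp (-N₀ ^ (2 * α))`. A ball of fixed radius in parameter space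
has larger prior mass once `N₀` is large, since the exponent of the Gaussian density there is only
of order `N₀ ^ α`; every ball hence contains a good network, which transfers the bound to every
network.

What remains are errors of order `N₀ ^ (-α)`. Either all training margins are at most `γ`, so that
the empirical loss is `1`, or the weights are bounded below and the norm term absorbs them.
-/

noncomputable section

namespace SubgroupGNN

/-! ### Lipschitz and continuity properties of the network -/

section Network

theorem specNorm_nonneg {m n : ℕ} (W : Matrix (Fin m) (Fin n) ℝ) : 0 ≤ specNorm W :=
  norm_nonneg _

theorem norm_toLp_mulVec_le_specNorm_mul {m n : ℕ} (W : Matrix (Fin m) (Fin n) ℝ)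
    (v : Fin n → ℝ) :
    ‖WithLp.toLp 2 (W.mulVec v)‖ ≤ specNorm W * ‖WithLp.toLp 2 v‖ := by
  simpa [specNorm, Matrix.toLpLin_toLp] using
    (Matrix.toEuclideanLin W).toContinuousLinearMap.le_opNorm (WithLp.toLp 2 v)

theorem frobSq_nonneg {m n : ℕ} (W : Matrix (Fin m) (Fin n) ℝ) : 0 ≤ frobSq W :=
  Finset.sum_nonneg fun _ _ => Finset.sum_nonneg fun _ _ => sq_nonneg _

theorem specNorm_le_sqrt_frobSq {m n : ℕ} (W : Matrix (Fin m) (Fin n) ℝ) :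
    specNorm W ≤ √(frobSq W) := by
  refine ContinuousLinearMap.opNorm_le_bound _ (Real.sqrt_nonneg _) fun x => ?_
  rw [EuclideanSpace.norm_eq, EuclideanSpace.norm_eq, ← Real.sqrt_mul (frobSq_nonneg W), frobSq,
    Finset.sum_mul]
  refine Real.sqrt_le_sqrt (Finset.sum_le_sum fun i _ => ?_)
  simpa [Matrix.toLpLin_apply, Matrix.mulVec, dotProduct, sq_abs] using
    Finset.sum_mul_sq_le_sq_mul_sq Finset.univ (fun j => W i j) (fun j => x j)

theorem sq_apply_le_frobSq {m n : ℕ} (W : Matrix (Fin m) (Fin n) ℝ) (i : Fin m) (j : Fin n) :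
    W i j ^ 2 ≤ frobSq W :=
  calc W i j ^ 2 ≤ ∑ j', W i j' ^ 2 :=
        Finset.single_le_sum (f := fun j' => W i j' ^ 2) (fun _ _ => sq_nonneg _)
          (Finset.mem_univ j)
    _ ≤ frobSq W :=
        Finset.single_le_sum (f := fun i' => ∑ j', W i' j' ^ 2)
          (fun _ _ => Finset.sum_nonneg fun _ _ => sq_nonneg _) (Finset.mem_univ i)

variable {D L : ℕ} {w : ℕ → ℕ}

theorem specNorm_le_maxSpec (θ : Params D L w) (l : Fin L) :
    specNorm (weight θ l) ≤ maxSpec θ :=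
  le_ciSup (f := fun l : Fin L => specNorm (weight θ l)) (Set.finite_range _).bddAbove l

theorem maxSpec_nonneg (θ : Params D L w) : 0 ≤ maxSpec θ :=
  Real.iSup_nonneg fun _ => specNorm_nonneg _

theorem sum_frobSq_nonneg (θ : Params D L w) : 0 ≤ ∑ l : Fin L, frobSq (weight θ l) :=
  Finset.sum_nonneg fun _ _ => frobSq_nonneg _

theorem maxSpec_sq_le_sum_frobSq (θ : Params D L w) :
    maxSpec θ ^ 2 ≤ ∑ l : Fin L, frobSq (weight θ l) := by
  refine (Real.le_sqrt (maxSpec_nonneg θ) (sum_frobSq_nonneg θ)).1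
    (Real.iSup_le (fun l => ?_) (Real.sqrt_nonneg _))
  refine (specNorm_le_sqrt_frobSq _).trans (Real.sqrt_le_sqrt ?_)
  exact Finset.single_le_sum (f := fun l : Fin L => frobSq (weight θ l))
    (fun _ _ => frobSq_nonneg _) (Finset.mem_univ l)

theorem norm_le_of_sqrt_frobSq_le [NeZero L] {θ : Params D L w} {C : ℝ}
    (h : ∀ l, √(frobSq (weight θ l)) ≤ C) : ‖θ‖ ≤ C := by
  have hC : 0 ≤ C := (Real.sqrt_nonneg _).trans (h 0)
  refine (pi_norm_le_iff_of_nonneg hC).2 fun ⟨l, i, j⟩ => ?_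
  exact (Real.abs_le_sqrt (sq_apply_le_frobSq (weight θ l) i j)).trans (h l)

theorem norm_toLp_le_of_abs_le {ι : Type*} [Fintype ι] {u v : ι → ℝ} (h : ∀ i, |u i| ≤ |v i|) :
    ‖WithLp.toLp 2 u‖ ≤ ‖WithLp.toLp 2 v‖ := by
  rw [EuclideanSpace.norm_eq, EuclideanSpace.norm_eq]
  refine Real.sqrt_le_sqrt (Finset.sum_le_sum fun i _ => ?_)
  simpa using sq_le_sq.2 (h i)

theorem norm_preact_sub_le (θ : Params D L w) (x x' : Feat D) :
    ∀ (l : ℕ) (h : l ≤ L),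
      ‖WithLp.toLp 2 (preact θ x l h - preact θ x' l h)‖ ≤ maxSpec θ ^ l * ‖x - x'‖
  | 0, _ => by
    rw [pow_zero, one_mul]
    exact le_of_eq rfl
  | l + 1, h => by
    have ih := norm_preact_sub_le θ x x' l (Nat.le_of_succ_le h)
    rw [preact, preact, ← Matrix.mulVec_sub, pow_succ', mul_assoc]
    refine (norm_toLp_mulVec_le_specNorm_mul _ _).trans ?_
    refine mul_le_mul (specNorm_le_maxSpec θ _) (le_trans ?_ ih) (norm_nonneg _)
      (maxSpec_nonneg θ)
    refine norm_toLp_le_of_abs_le fun i => ?_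
    simp only [Pi.sub_apply]
    split_ifs
    · exact le_rfl
    · exact abs_max_sub_max_le_abs _ _ _

theorem preact_zero (θ : Params D L w) : ∀ (l : ℕ) (h : l ≤ L), preact θ 0 l h = 0
  | 0, _ => rfl
  | l + 1, h => by
    rw [preact, preact_zero θ l (Nat.le_of_succ_le h)]
    simp only [Pi.zero_apply, max_self, ite_self]
    exact Matrix.mulVec_zero _

theorem logits_zero [NeZero L] (θ : Params D L w) : logits θ 0 = 0 := by
  ext k
  rw [logits, preact_zero, Pi.zero_apply, Pi.zero_apply]

theorem dist_logits_le [NeZero L] (θ : Params D L w) (x x' : Feat D) :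
    dist (logits θ x) (logits θ x') ≤ maxSpec θ ^ L * ‖x - x'‖ := by
  refine (dist_pi_le_iff (mul_nonneg (pow_nonneg (maxSpec_nonneg θ) L) (norm_nonneg _))).2
    fun k => le_trans ?_ (norm_preact_sub_le θ x x' L le_rfl)
  exact PiLp.norm_apply_le (WithLp.toLp 2 (preact θ x L le_rfl - preact θ x' L le_rfl)) _

theorem abs_logits_le [NeZero L] (θ : Params D L w) (x : Feat D) (k : Label) :
    |logits θ x k| ≤ maxSpec θ ^ L * ‖x‖ := by
  have h := (dist_le_pi_dist (logits θ x) (logits θ 0) k).trans (dist_logits_le θ x 0)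
  rwa [logits_zero, Pi.zero_apply, dist_zero_right, sub_zero] at h

theorem continuous_preact : ∀ (l : ℕ) (h : l ≤ L) (i : Fin (width D L w l)),
    Continuous fun z : Params D L w × Feat D => preact z.1 z.2 l h i
  | 0, _, i => by
    simp only [preact]
    fun_prop
  | l + 1, h, i => by
    have ih := continuous_preact l (Nat.le_of_succ_le h)
    simp only [preact, Matrix.mulVec, dotProduct, weight, Matrix.of_apply]
    refine continuous_finsetSum _ fun j _ => Continuous.mul (by fun_prop) ?_
    split_ifs
    · exact ih j
    · exact (ih j).max continuous_const

theorem continuous_logits [NeZero L] :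
    Continuous fun z : Params D L w × Feat D => logits z.1 z.2 :=
  continuous_pi fun _ => continuous_preact L le_rfl _

theorem exists_forall_dist_logits_le (D L : ℕ) [NeZero L] (w : ℕ → ℕ) (R B : ℝ) {η : ℝ}
    (hη : 0 < η) :
    ∃ r ∈ Set.Ioc (0 : ℝ) 1, ∀ θ θ' : Params D L w, ‖θ‖ ≤ R → ‖θ'‖ ≤ R → dist θ θ' < r →
      ∀ x : Feat D, ‖x‖ ≤ B → dist (logits θ x) (logits θ' x) ≤ η := by
  have hcomp : IsCompact (Metric.closedBall (0 : Params D L w) R ×ˢ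
      Metric.closedBall (0 : Feat D) B) :=
    (isCompact_closedBall _ _).prod (isCompact_closedBall _ _)
  obtain ⟨r, hr, h⟩ := Metric.uniformContinuousOn_iff.1
    (hcomp.uniformContinuousOn_of_continuous continuous_logits.continuousOn) η hη
  refine ⟨min r 1, ⟨lt_min hr one_pos, min_le_right _ _⟩, fun θ θ' hθ hθ' hd x hx => ?_⟩
  exact (h (θ, x) ⟨by simpa using hθ, by simpa using hx⟩ (θ', x)
    ⟨by simpa using hθ', by simpa using hx⟩
    (by simpa [Prod.dist_eq, hr] using hd.trans_le (min_le_left _ _))).le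

theorem exists_finset_dist_logits_le (D L : ℕ) [NeZero L] (w : ℕ → ℕ) (R B : ℝ) {η : ℝ}
    (hη : 0 < η) :
    ∃ F : Finset (Params D L w), ∀ θ : Params D L w, ‖θ‖ ≤ R →
      ∃ θ' ∈ F, ∀ x : Feat D, ‖x‖ ≤ B → dist (logits θ x) (logits θ' x) ≤ η := by
  obtain ⟨r, hr, hclose⟩ := exists_forall_dist_logits_le D L w R B hη
  obtain ⟨F, hFR, hF, hcover⟩ :=
    (isCompact_closedBall (0 : Params D L w) R).finite_cover_balls hr.1
  refine ⟨hF.toFinset, fun θ hθ => ?_⟩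
  obtain ⟨θ', hθ'F, hθ'⟩ := Set.mem_iUnion₂.1 (hcover (mem_closedBall_zero_iff.2 hθ))
  exact ⟨θ', hF.mem_toFinset.2 hθ'F,
    hclose θ θ' hθ (mem_closedBall_zero_iff.1 (hFR hθ'F)) (Metric.mem_ball.1 hθ')⟩

end Network

/-! ### The posterior as a logistic function of the feature -/

section Posterior

theorem lipschitzWith_sigmoid : LipschitzWith 1 Real.sigmoid := by
  refine lipschitzWith_of_nnnorm_deriv_le differentiable_sigmoid fun x => ?_
  have h0 := Real.sigmoid_pos x
  have h1 := Real.sigmoid_lt_one x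
  rw [Real.deriv_sigmoid, ← NNReal.coe_le_coe, coe_nnnorm, Real.norm_eq_abs, NNReal.coe_one,
    abs_le]
  constructor <;> nlinarith

theorem norm_sub_sq_sub_norm_sub_sq {E : Type*} [NormedAddCommGroup E] [InnerProductSpace ℝ E]
    (f a b : E) :
    ‖f - b‖ ^ 2 - ‖f - a‖ ^ 2 = inner ℝ ((2 : ℝ) • f - (a + b)) (a - b) := by
  rw [show (2 : ℝ) • f - (a + b) = f - b + (f - a) by rw [two_smul]; abel,
    show a - b = f - b - (f - a) by abel]
  generalize f - b = u, f - a = v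
  rw [inner_add_left, inner_sub_right, inner_sub_right, real_inner_self_eq_norm_sq,
    real_inner_self_eq_norm_sq, real_inner_comm]
  ring

/-- The log-odds of the first class at a node with aggregated feature `f` in a subgroup of
homophily ratio `h`: the posterior probability of that class is its sigmoid. -/
def logOdds {D : ℕ} (μ₁ μ₂ : Feat D) (σ h : ℝ) (f : Feat D) : ℝ :=
  (2 * h - 1) * inner ℝ ((2 : ℝ) • f - (μ₁ + μ₂)) (μ₁ - μ₂) / (2 * σ ^ 2)

/-- The factor by which differences of posteriors may exceed `shiftTerm` on features of norm at
most `B`. For `μ₁ = μ₂` the quotient is `0` by convention, as is `shiftTerm`. -/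
def shiftConst {D : ℕ} (μ₁ μ₂ : Feat D) (σ B : ℝ) : ℝ :=
  √(2 * Real.pi) / σ * max 1 ((2 * B + ‖μ₁ + μ₂‖) / ‖μ₁ - μ₂‖)

variable {D : ℕ} (μ₁ μ₂ : Feat D) {σ : ℝ} (p q : ℝ)

theorem aggMean_zero_add_aggMean_one (hpq : p + q ≠ 0) :
    aggMean μ₁ μ₂ p q 0 + aggMean μ₁ μ₂ p q 1 = μ₁ + μ₂ := by
  simp only [aggMean, if_true, one_ne_zero, if_false]
  match_scalars <;> field_simp
  ring

theorem aggMean_zero_sub_aggMean_one (hpq : p + q ≠ 0) :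
    aggMean μ₁ μ₂ p q 0 - aggMean μ₁ μ₂ p q 1 = (2 * homophily p q - 1) • (μ₁ - μ₂) := by
  simp only [aggMean, homophily, if_true, one_ne_zero, if_false]
  match_scalars <;> (field_simp; ring)

theorem logOdds_homophily (hpq : p + q ≠ 0) (f : Feat D) :
    logOdds μ₁ μ₂ σ (homophily p q) f =
      -‖f - aggMean μ₁ μ₂ p q 0‖ ^ 2 / (2 * σ ^ 2) -
        -‖f - aggMean μ₁ μ₂ p q 1‖ ^ 2 / (2 * σ ^ 2) := by
  have h := norm_sub_sq_sub_norm_sub_sq f (aggMean μ₁ μ₂ p q 0) (aggMean μ₁ μ₂ p q 1)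
  rw [aggMean_zero_add_aggMean_one μ₁ μ₂ p q hpq, aggMean_zero_sub_aggMean_one μ₁ μ₂ p q hpq,
    real_inner_smul_right] at h
  rw [logOdds, ← h]
  ring

variable {p q} in
theorem abs_two_mul_homophily_sub_one_le (hp : 0 ≤ p) (hq : 0 ≤ q) :
    |2 * homophily p q - 1| ≤ 1 := by
  have h0 : 0 ≤ homophily p q := div_nonneg hp (add_nonneg hp hq)
  have h1 : homophily p q ≤ 1 := div_le_one_of_le₀ (by linarith) (add_nonneg hp hq)
  exact abs_le.2 ⟨by linarith, by linarith⟩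

theorem abs_logOdds_sub_le (σ : ℝ) {B h h' ε : ℝ} (hh : |2 * h - 1| ≤ 1) {f f' : Feat D}
    (hf' : ‖f'‖ ≤ B) (hε : ‖f - f'‖ ≤ ε) :
    |logOdds μ₁ μ₂ σ h f - logOdds μ₁ μ₂ σ h' f'| ≤
      ‖μ₁ - μ₂‖ * (ε + |h' - h| * (2 * B + ‖μ₁ + μ₂‖)) / σ ^ 2 := by
  have hdecomp : logOdds μ₁ μ₂ σ h f - logOdds μ₁ μ₂ σ h' f' =
      ((2 * h - 1) * inner ℝ (f - f') (μ₁ - μ₂) -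
        (h' - h) * inner ℝ ((2 : ℝ) • f' - (μ₁ + μ₂)) (μ₁ - μ₂)) / σ ^ 2 := by
    simp only [logOdds, inner_sub_left, real_inner_smul_left]
    ring
  have hfeat : |inner ℝ (f - f') (μ₁ - μ₂)| ≤ ε * ‖μ₁ - μ₂‖ :=
    (abs_real_inner_le_norm _ _).trans (by gcongr)
  have hcenter : |inner ℝ ((2 : ℝ) • f' - (μ₁ + μ₂)) (μ₁ - μ₂)| ≤
      (2 * B + ‖μ₁ + μ₂‖) * ‖μ₁ - μ₂‖ := by
    refine (abs_real_inner_le_norm _ _).trans ?_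
    gcongr
    refine (norm_sub_le _ _).trans ?_
    rw [norm_smul, Real.norm_eq_abs, abs_two]
    linarith
  rw [hdecomp, abs_div, abs_of_nonneg (sq_nonneg σ)]
  gcongr
  refine (abs_sub _ _).trans ?_
  rw [abs_mul, abs_mul]
  calc |2 * h - 1| * |inner ℝ (f - f') (μ₁ - μ₂)| +
        |h' - h| * |inner ℝ ((2 : ℝ) • f' - (μ₁ + μ₂)) (μ₁ - μ₂)|
      ≤ 1 * (ε * ‖μ₁ - μ₂‖) + |h' - h| * ((2 * B + ‖μ₁ + μ₂‖) * ‖μ₁ - μ₂‖) := by gcongr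
    _ = ‖μ₁ - μ₂‖ * (ε + |h' - h| * (2 * B + ‖μ₁ + μ₂‖)) := by ring

variable (hσ : 0 < σ)

include hσ

theorem gaussDensity_pos (m f : Feat D) : 0 < gaussDensity σ m f := by
  rw [gaussDensity]
  positivity

theorem classPosterior_zero (hpq : p + q ≠ 0) (f : Feat D) :
    classPosterior μ₁ μ₂ σ p q f 0 = Real.sigmoid (logOdds μ₁ μ₂ σ (homophily p q) f) := by
  rw [logOdds_homophily μ₁ μ₂ p q hpq, Real.sigmoid_def, neg_sub, Real.exp_sub]
  simp only [classPosterior, classPrior, gaussDensity, Fin.sum_univ_two]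
  field_simp

theorem sum_classPosterior (f : Feat D) : ∑ k, classPosterior μ₁ μ₂ σ p q f k = 1 := by
  have h := fun k => gaussDensity_pos hσ (aggMean μ₁ μ₂ p q k) f
  simp only [classPosterior, ← Finset.sum_div]
  refine div_self (Finset.sum_pos (fun k _ => ?_) Finset.univ_nonempty).ne'
  exact mul_pos (by norm_num [classPrior]) (h k)

theorem classPosterior_nonneg (f : Feat D) (k : Label) :
    0 ≤ classPosterior μ₁ μ₂ σ p q f k := by
  have h := fun l => gaussDensity_pos hσ (aggMean μ₁ μ₂ p q l) f
  refine div_nonneg (mul_nonneg (by norm_num [classPrior]) (h k).le) ?_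
  exact Finset.sum_nonneg fun l _ => mul_nonneg (by norm_num [classPrior]) (h l).le

variable {p q} in
theorem abs_classPosterior_sub_le {p' q' : ℝ} (hpq : p + q ≠ 0) (hpq' : p' + q' ≠ 0)
    (f f' : Feat D) (k : Label) :
    |classPosterior μ₁ μ₂ σ p q f k - classPosterior μ₁ μ₂ σ p' q' f' k| ≤
      |logOdds μ₁ μ₂ σ (homophily p q) f - logOdds μ₁ μ₂ σ (homophily p' q') f'| := by
  have h0 : |classPosterior μ₁ μ₂ σ p q f 0 - classPosterior μ₁ μ₂ σ p' q' f' 0| ≤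
      |logOdds μ₁ μ₂ σ (homophily p q) f - logOdds μ₁ μ₂ σ (homophily p' q') f'| := by
    rw [classPosterior_zero μ₁ μ₂ p q hσ hpq, classPosterior_zero μ₁ μ₂ p' q' hσ hpq']
    simpa [Real.dist_eq] using lipschitzWith_sigmoid.dist_le_mul _ _
  have hsum := sum_classPosterior μ₁ μ₂ p q hσ f
  have hsum' := sum_classPosterior μ₁ μ₂ p' q' hσ f'
  rw [Fin.sum_univ_two] at hsum hsum'
  match k with
  | 0 => exact h0
  | 1 =>
    rw [eq_sub_of_add_eq' hsum, eq_sub_of_add_eq' hsum', sub_sub_sub_cancel_left, abs_sub_comm]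
    exact h0

theorem shiftConst_nonneg (B : ℝ) : 0 ≤ shiftConst μ₁ μ₂ σ B :=
  mul_nonneg (by positivity) (zero_le_one.trans (le_max_left _ _))

theorem shiftTerm_nonneg {ε Δ : ℝ} (hε : 0 ≤ ε) (hΔ : 0 ≤ Δ) :
    0 ≤ shiftTerm μ₁ μ₂ σ ε Δ := by
  rw [shiftTerm]
  positivity

theorem two_mul_le_shiftConst_mul_shiftTerm (B : ℝ) {ε Δ : ℝ} (hε : 0 ≤ ε) (hΔ : 0 ≤ Δ) :
    2 * (‖μ₁ - μ₂‖ * (ε + Δ * (2 * B + ‖μ₁ + μ₂‖)) / σ ^ 2) ≤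
      shiftConst μ₁ μ₂ σ B * shiftTerm μ₁ μ₂ σ ε Δ := by
  rw [shiftConst, shiftTerm]
  set Q := 2 * B + ‖μ₁ + μ₂‖
  rcases (norm_nonneg (μ₁ - μ₂)).eq_or_lt with h0 | hpos
  · simp [← h0]
  set ρ := ‖μ₁ - μ₂‖
  have hmax : ε + Δ * Q ≤ max 1 (Q / ρ) * (ε + Δ * ρ) := by
    have h1 : ε ≤ max 1 (Q / ρ) * ε := le_mul_of_one_le_left hε (le_max_left _ _)
    have h2 : Q ≤ max 1 (Q / ρ) * ρ := (div_le_iff₀ hpos).1 (le_max_right _ _)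
    linarith [mul_le_mul_of_nonneg_left h2 hΔ]
  calc 2 * (ρ * (ε + Δ * Q) / σ ^ 2)
      ≤ 2 * (ρ * (max 1 (Q / ρ) * (ε + Δ * ρ)) / σ ^ 2) := by gcongr
    _ = _ := by
      rw [numClasses]
      push_cast
      field_simp

end Posterior

/-! ### Margin losses -/

section Loss

theorem iSup_ne_label (z : Label → ℝ) (y : Label) :
    ⨆ k : {k : Label // k ≠ y}, z k = z (1 - y) := by
  have hne : ∀ y : Label, 1 - y ≠ y := by decide
  have huniq : ∀ y k : Label, k ≠ y → k = 1 - y := by decide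
  let _ : Unique {k : Label // k ≠ y} :=
    { default := ⟨1 - y, hne y⟩
      uniq := fun k => Subtype.ext (huniq y k k.2) }
  exact ciSup_unique

theorem marginLoss_mem_Icc (γ : ℝ) (z : Label → ℝ) (y : Label) :
    marginLoss γ z y ∈ Set.Icc (0 : ℝ) 1 := by
  rw [marginLoss]
  split_ifs <;> simp

theorem marginLoss_le_marginLoss {γ γ' η : ℝ} {z z' : Label → ℝ} (hz : dist z z' ≤ η)
    (hγ : γ + 2 * η ≤ γ') (y : Label) : marginLoss γ z y ≤ marginLoss γ' z' y := by
  have hcoord : ∀ k, |z k - z' k| ≤ η := fun k => (dist_le_pi_dist z z' k).trans hz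
  have hy := abs_le.1 (hcoord y)
  have hother := abs_le.1 (hcoord (1 - y))
  rw [marginLoss, marginLoss, iSup_ne_label, iSup_ne_label]
  split_ifs with h h'
  · exact le_rfl
  · exact absurd (by linarith) h'
  · exact zero_le_one
  · exact le_rfl

variable {n D L : ℕ} [NeZero L] {w : ℕ → ℕ} {g : Fin n → Feat D} {S : Finset (Fin n)}

theorem empLoss_le_one (g : Fin n → Feat D) (S : Finset (Fin n)) (γ : ℝ) (θ : Params D L w)
    (y : S → Label) : empLoss g S γ θ y ≤ 1 := by
  refine inv_mul_le_one_of_le₀ ?_ (Nat.cast_nonneg _)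
  simpa using Finset.sum_le_card_nsmul (Finset.univ : Finset S) _ 1
    fun i _ => (marginLoss_mem_Icc γ (logits θ (g i)) (y i)).2

theorem empLoss_mono {γ γ' η : ℝ} {θ θ' : Params D L w}
    (hz : ∀ i ∈ S, dist (logits θ (g i)) (logits θ' (g i)) ≤ η) (hγ : γ + 2 * η ≤ γ')
    (y : S → Label) : empLoss g S γ θ y ≤ empLoss g S γ' θ' y := by
  rw [empLoss, empLoss]
  gcongr with i
  exact marginLoss_le_marginLoss (hz i i.2) hγ _

theorem empLoss_eq_one_or_le_maxSpec_pow (hS : S.Nonempty) {B : ℝ} (hB0 : 0 < B)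
    (hB : ∀ i ∈ S, ‖g i‖ ≤ B) (γ : ℝ) (θ : Params D L w) (y : S → Label) :
    empLoss g S γ θ y = 1 ∨ γ / (2 * B) ≤ maxSpec θ ^ L := by
  by_cases h : ∀ i : S, logits θ (g i) (y i) ≤ γ + logits θ (g i) (1 - y i)
  · have hcard : (S.card : ℝ) ≠ 0 := by exact_mod_cast hS.card_pos.ne'
    have hloss : ∀ i : S, marginLoss γ (logits θ (g i)) (y i) = 1 := fun i => by
      rw [marginLoss, iSup_ne_label, if_pos (h i)]
    simp [empLoss, hloss, hcard]
  · push Not at h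
    obtain ⟨i, hi⟩ := h
    have hlogit : ∀ k, |logits θ (g i) k| ≤ maxSpec θ ^ L * B := fun k =>
      (abs_logits_le θ (g i) k).trans
        (mul_le_mul_of_nonneg_left (hB i i.2) (pow_nonneg (maxSpec_nonneg θ) L))
    right
    rw [div_le_iff₀ (by positivity)]
    linarith [(abs_le.1 (hlogit (y i))).2, (abs_le.1 (hlogit (1 - y i))).1]

/-- Expected margin loss of one node with aggregated feature `f` and logits `z`; `expLoss` is its
mean over the subgroup. -/
def nodeLoss (μ₁ μ₂ : Feat D) (σ p q : ℝ) (f : Feat D) (γ : ℝ) (z : Label → ℝ) : ℝ :=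
  ∑ k, classPosterior μ₁ μ₂ σ p q f k * marginLoss γ z k

variable (μ₁ μ₂ : Feat D) {σ : ℝ} (p q : ℝ) (hσ : 0 < σ)

include hσ

theorem isProbabilityMeasure_labelDist (f : Feat D) :
    IsProbabilityMeasure (labelDist μ₁ μ₂ σ p q f) := by
  refine ⟨?_⟩
  simp only [labelDist, Measure.finsetSum_apply, Measure.smul_apply, measure_univ, smul_eq_mul,
    mul_one]
  rw [← ENNReal.ofReal_sum_of_nonneg fun k _ => classPosterior_nonneg μ₁ μ₂ p q hσ f k,
    sum_classPosterior μ₁ μ₂ p q hσ, ENNReal.ofReal_one]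

theorem integral_labelDist (f : Feat D) (u : Label → ℝ) :
    ∫ k, u k ∂labelDist μ₁ μ₂ σ p q f = ∑ k, classPosterior μ₁ μ₂ σ p q f k * u k := by
  rw [labelDist, integral_finsetSum_measure]
  · refine Finset.sum_congr rfl fun k _ => ?_
    rw [integral_smul_measure, integral_dirac,
      ENNReal.toReal_ofReal (classPosterior_nonneg μ₁ μ₂ p q hσ f k), smul_eq_mul]
  · exact fun k _ => (integrable_dirac (by simp)).smul_measure ENNReal.ofReal_ne_top

theorem isProbabilityMeasure_labelLaw (g : Fin n → Feat D) (S : Finset (Fin n)) :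
    IsProbabilityMeasure (labelLaw μ₁ μ₂ σ p q g S) := by
  have := fun i : S => isProbabilityMeasure_labelDist μ₁ μ₂ p q hσ (g i)
  rw [labelLaw]
  infer_instance

theorem integral_labelLaw_eval (g : Fin n → Feat D) (S : Finset (Fin n)) (i : S)
    (u : Label → ℝ) :
    ∫ y, u (y i) ∂labelLaw μ₁ μ₂ σ p q g S = ∫ k, u k ∂labelDist μ₁ μ₂ σ p q (g i) := by
  have := fun i : S => isProbabilityMeasure_labelDist μ₁ μ₂ p q hσ (g i)
  exact integral_comp_eval (μ := fun i : S => labelDist μ₁ μ₂ σ p q (g i)) (i := i) (f := u)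
    (measurable_of_finite u).aestronglyMeasurable

theorem expLoss_eq (g : Fin n → Feat D) (S : Finset (Fin n)) (γ : ℝ) (θ : Params D L w) :
    expLoss μ₁ μ₂ σ p q g S γ θ =
      (S.card : ℝ)⁻¹ * ∑ i ∈ S, nodeLoss μ₁ μ₂ σ p q (g i) γ (logits θ (g i)) := by
  have := isProbabilityMeasure_labelLaw μ₁ μ₂ p q hσ g S
  simp only [expLoss, empLoss]
  rw [integral_const_mul, integral_finsetSum _ fun i _ => .of_finite, ← Finset.sum_coe_sort S]
  congr 1
  refine Finset.sum_congr rfl fun i _ => ?_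
  rw [integral_labelLaw_eval μ₁ μ₂ p q hσ, integral_labelDist μ₁ μ₂ p q hσ, nodeLoss]

theorem expLoss_mono {γ γ' η : ℝ} {θ θ' : Params D L w}
    (hz : ∀ i ∈ S, dist (logits θ (g i)) (logits θ' (g i)) ≤ η) (hγ : γ + 2 * η ≤ γ') :
    expLoss μ₁ μ₂ σ p q g S γ θ ≤ expLoss μ₁ μ₂ σ p q g S γ' θ' := by
  have := isProbabilityMeasure_labelLaw μ₁ μ₂ p q hσ g S
  exact integral_mono .of_finite .of_finite fun y => empLoss_mono hz hγ y

theorem expLoss_le_one (g : Fin n → Feat D) (S : Finset (Fin n)) (γ : ℝ) (θ : Params D L w) :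
    expLoss μ₁ μ₂ σ p q g S γ θ ≤ 1 := by
  have := isProbabilityMeasure_labelLaw μ₁ μ₂ p q hσ g S
  calc expLoss μ₁ μ₂ σ p q g S γ θ ≤ ∫ _, (1 : ℝ) ∂labelLaw μ₁ μ₂ σ p q g S :=
        integral_mono .of_finite .of_finite fun y => empLoss_le_one g S γ θ y
    _ = 1 := by simp

variable {p q}

theorem nodeLoss_le_add_abs_logOdds_sub {p' q' γ γ' η : ℝ} (hpq : p + q ≠ 0)
    (hpq' : p' + q' ≠ 0) (f f' : Feat D) {z z' : Label → ℝ} (hz : dist z z' ≤ η)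
    (hγ : γ + 2 * η ≤ γ') :
    nodeLoss μ₁ μ₂ σ p q f γ z ≤ nodeLoss μ₁ μ₂ σ p' q' f' γ' z' +
      2 * |logOdds μ₁ μ₂ σ (homophily p q) f - logOdds μ₁ μ₂ σ (homophily p' q') f'| := by
  set Λ := |logOdds μ₁ μ₂ σ (homophily p q) f - logOdds μ₁ μ₂ σ (homophily p' q') f'|
  have hlabel : ∀ k, classPosterior μ₁ μ₂ σ p q f k * marginLoss γ z k ≤
      classPosterior μ₁ μ₂ σ p' q' f' k * marginLoss γ' z' k + Λ := by
    intro k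
    have hpost : classPosterior μ₁ μ₂ σ p q f k - classPosterior μ₁ μ₂ σ p' q' f' k ≤ Λ :=
      (le_abs_self _).trans (abs_classPosterior_sub_le μ₁ μ₂ hσ hpq hpq' f f' k)
    obtain ⟨hm0, hm1⟩ := marginLoss_mem_Icc γ' z' k
    calc classPosterior μ₁ μ₂ σ p q f k * marginLoss γ z k
        ≤ classPosterior μ₁ μ₂ σ p q f k * marginLoss γ' z' k :=
          mul_le_mul_of_nonneg_left (marginLoss_le_marginLoss hz hγ k)
            (classPosterior_nonneg μ₁ μ₂ p q hσ f k)
      _ ≤ (classPosterior μ₁ μ₂ σ p' q' f' k + Λ) * marginLoss γ' z' k := by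
          gcongr
          linarith
      _ ≤ classPosterior μ₁ μ₂ σ p' q' f' k * marginLoss γ' z' k + Λ := by
          rw [add_mul]
          gcongr
          exact mul_le_of_le_one_right (abs_nonneg _) hm1
  simp only [nodeLoss, Fin.sum_univ_two]
  linarith [hlabel 0, hlabel 1]

theorem nodeLoss_le_add_shiftTerm {p' q' B ε γ γ' η : ℝ} (hp : 0 ≤ p) (hq : 0 ≤ q)
    (hpq : p + q ≠ 0) (hpq' : p' + q' ≠ 0) {f f' : Feat D} (hf' : ‖f'‖ ≤ B)
    (hε : ‖f - f'‖ ≤ ε) {z z' : Label → ℝ} (hz : dist z z' ≤ η) (hγ : γ + 2 * η ≤ γ') :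
    nodeLoss μ₁ μ₂ σ p q f γ z ≤ nodeLoss μ₁ μ₂ σ p' q' f' γ' z' +
      shiftConst μ₁ μ₂ σ B * shiftTerm μ₁ μ₂ σ ε |homophily p' q' - homophily p q| := by
  refine (nodeLoss_le_add_abs_logOdds_sub μ₁ μ₂ hσ hpq hpq' f f' hz hγ).trans ?_
  rw [add_le_add_iff_left]
  refine le_trans ?_ (two_mul_le_shiftConst_mul_shiftTerm μ₁ μ₂ hσ B
    ((norm_nonneg _).trans hε) (abs_nonneg _))
  gcongr
  exact abs_logOdds_sub_le μ₁ μ₂ σ (abs_two_mul_homophily_sub_one_le hp hq) hf' hε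

end Loss

/-! ### Comparison of the test subgroup with the training nodes -/

section NearSets

variable {n D : ℕ} (g : Fin n → Feat D) {V₀ V : Finset (Fin n)}

theorem norm_le_maxNorm {i : Fin n} (hi : i ∈ V₀ ∨ i ∈ V) : ‖g i‖ ≤ maxNorm g V₀ V :=
  le_ciSup (f := fun i : {i : Fin n // i ∈ V₀ ∨ i ∈ V} => ‖g i‖)
    (Set.finite_range _).bddAbove ⟨i, hi⟩

theorem exists_mem_nearSet (hV₀ : V₀.Nonempty) {j : Fin n} (hj : j ∈ V) :
    ∃ i ∈ V₀, j ∈ nearSet g V₀ V i := by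
  have := hV₀.to_subtype
  obtain ⟨i, hi⟩ := exists_eq_ciInf_of_finite (f := fun i : V₀ => ‖g i - g j‖)
  refine ⟨i, i.2, Finset.mem_filter.2 ⟨hj, hi.le.trans ?_⟩⟩
  exact le_ciSup (f := fun j : V => ⨅ i : V₀, ‖g i - g j‖) (Set.finite_range _).bddAbove ⟨j, hj⟩

theorem biUnion_nearSet (hV₀ : V₀.Nonempty) : V₀.biUnion (nearSet g V₀ V) = V := by
  ext j
  rw [Finset.mem_biUnion]
  exact ⟨fun ⟨_, _, hj⟩ => (Finset.mem_filter.1 hj).1, exists_mem_nearSet g hV₀⟩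

theorem featDist_le_two_mul_maxNorm (hV₀ : V₀.Nonempty) :
    featDist g V₀ V ≤ 2 * maxNorm g V₀ V := by
  obtain ⟨i, hi⟩ := hV₀
  have hi' : ‖g i‖ ≤ maxNorm g V₀ V := norm_le_maxNorm g (.inl hi)
  refine Real.iSup_le (fun j => ?_) (by linarith [norm_nonneg (g i)])
  refine (ciInf_le (Set.finite_range _).bddBelow (⟨i, hi⟩ : V₀)).trans ?_
  refine (norm_sub_le _ _).trans ?_
  linarith [norm_le_maxNorm g (V₀ := V₀) (.inr j.2)]

theorem featDist_nonneg : 0 ≤ featDist g V₀ V :=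
  Real.iSup_nonneg fun _ => Real.iInf_nonneg fun _ => norm_nonneg _

variable {g}

theorem inv_card_mul_sum_le_of_equalDisjointNearSets (hV₀ : V₀.Nonempty)
    (hnear : EqualDisjointNearSets g V₀ V) {a b : Fin n → ℝ}
    (hab : ∀ i ∈ V₀, ∀ j ∈ nearSet g V₀ V i, a j ≤ b i) :
    (V.card : ℝ)⁻¹ * ∑ j ∈ V, a j ≤ (V₀.card : ℝ)⁻¹ * ∑ i ∈ V₀, b i := by
  obtain ⟨hdisj, s, hs, hcard⟩ := hnear
  have hVcard : V.card = V₀.card * s := by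
    conv_lhs => rw [← biUnion_nearSet g (V := V) hV₀]
    rw [Finset.card_biUnion hdisj, Finset.sum_congr rfl hcard, Finset.sum_const, smul_eq_mul]
  have hsum : ∑ j ∈ V, a j ≤ s * ∑ i ∈ V₀, b i := by
    conv_lhs => rw [← biUnion_nearSet g (V := V) hV₀]
    rw [Finset.sum_biUnion hdisj, Finset.mul_sum]
    refine Finset.sum_le_sum fun i hi => ?_
    rw [← hcard i hi, ← nsmul_eq_mul]
    exact Finset.sum_le_card_nsmul _ _ _ (hab i hi)
  have hs' : (s : ℝ) ≠ 0 := by exact_mod_cast hs.ne'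
  refine (mul_le_mul_of_nonneg_left hsum (by positivity)).trans_eq ?_
  rw [hVcard]
  push_cast
  field_simp

theorem expLoss_le_expLoss_of_maxSpec (μ₁ μ₂ : Feat D) {σ p q p₀ q₀ B γ γ' η : ℝ} (hσ : 0 < σ)
    (hp : 0 ≤ p) (hq : 0 ≤ q) (hpq : p + q ≠ 0) (hpq₀ : p₀ + q₀ ≠ 0) (hV₀ : V₀.Nonempty)
    (hB : ∀ i ∈ V₀, ‖g i‖ ≤ B) (hnear : EqualDisjointNearSets g V₀ V) {L : ℕ} [NeZero L]
    {w : ℕ → ℕ} {θ : Params D L w} (hθ : maxSpec θ ^ L * featDist g V₀ V ≤ η)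
    (hγ : γ + 2 * η ≤ γ') :
    expLoss μ₁ μ₂ σ p q g V γ θ ≤ expLoss μ₁ μ₂ σ p₀ q₀ g V₀ γ' θ +
      shiftConst μ₁ μ₂ σ B * shiftTerm μ₁ μ₂ σ (featDist g V₀ V)
        |homophily p₀ q₀ - homophily p q| := by
  have hcard : (V₀.card : ℝ) ≠ 0 := by exact_mod_cast hV₀.card_pos.ne'
  rw [expLoss_eq μ₁ μ₂ p q hσ, expLoss_eq μ₁ μ₂ p₀ q₀ hσ]
  refine (inv_card_mul_sum_le_of_equalDisjointNearSets hV₀ hnear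
    (b := fun i => nodeLoss μ₁ μ₂ σ p₀ q₀ (g i) γ' (logits θ (g i)) +
      shiftConst μ₁ μ₂ σ B * shiftTerm μ₁ μ₂ σ (featDist g V₀ V)
        |homophily p₀ q₀ - homophily p q|) fun i hi j hj => ?_).trans_eq ?_
  · have hij : ‖g j - g i‖ ≤ featDist g V₀ V := by
      rw [norm_sub_rev]
      exact (Finset.mem_filter.1 hj).2
    refine nodeLoss_le_add_shiftTerm μ₁ μ₂ hσ hp hq hpq hpq₀ (hB i hi) hij ?_ hγ
    exact (dist_logits_le θ _ _).trans
      ((mul_le_mul_of_nonneg_left hij (pow_nonneg (maxSpec_nonneg θ) L)).trans hθ)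
  · rw [Finset.sum_add_distrib, Finset.sum_const, nsmul_eq_mul, mul_add,
      inv_mul_cancel_left₀ hcard]

end NearSets

/-! ### Concentration of the empirical loss -/

section Concentration

theorem measureReal_le_sum_integral_sub_le {ι : Type*} [Fintype ι] {Ω : ι → Type*}
    [∀ i, MeasurableSpace (Ω i)] (μ : ∀ i, Measure (Ω i)) [∀ i, IsProbabilityMeasure (μ i)]
    {u : ∀ i, Ω i → ℝ} (hu : ∀ i, Measurable (u i)) (hu01 : ∀ i x, u i x ∈ Set.Icc (0 : ℝ) 1)
    {t : ℝ} (ht : 0 ≤ t) :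
    (Measure.pi μ).real {y | t ≤ ∑ i, (∫ x, u i x ∂μ i - u i (y i))} ≤
      Real.exp (-(2 * t ^ 2 / Fintype.card ι)) := by
  have hint : ∀ i, ∫ y, u i (y i) ∂Measure.pi μ = ∫ x, u i x ∂μ i := fun i =>
    integral_comp_eval (hu i).aestronglyMeasurable
  have hsubgaussian : ∀ i ∈ Finset.univ, HasSubgaussianMGF
      (fun y => ∫ x, u i x ∂μ i - u i (y i)) ((‖(1 : ℝ) - 0‖₊ / 2) ^ 2) (Measure.pi μ) := by
    intro i _
    have h := (hasSubgaussianMGF_of_mem_Icc (μ := Measure.pi μ) (X := fun y => u i (y i))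
      ((hu i).comp (measurable_pi_apply i)).aemeasurable (ae_of_all _ fun y => hu01 i (y i))).neg
    refine h.congr (ae_of_all _ fun y => ?_)
    simp only [Pi.neg_apply, hint, neg_sub]
  have hindep : iIndepFun (fun i y => ∫ x, u i x ∂μ i - u i (y i)) (Measure.pi μ) :=
    iIndepFun_pi (X := fun i x => ∫ x, u i x ∂μ i - u i x)
      fun i => ((hu i).const_sub _).aemeasurable
  refine (HasSubgaussianMGF.measure_sum_ge_le_of_iIndepFun hindep hsubgaussian ht).trans_eq ?_
  congr 1
  simp only [sub_zero, nnnorm_one, Finset.sum_const, Finset.card_univ]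
  push_cast
  ring

theorem ofReal_one_sub_le_measure_forall_notMem {Ω κ : Type*} [MeasurableSpace Ω]
    (μ : Measure Ω) [IsProbabilityMeasure μ] {F : Finset κ} {s : κ → Set Ω}
    (hs : ∀ k ∈ F, MeasurableSet (s k)) {δ : ℝ} (hδ : ∑ k ∈ F, μ.real (s k) ≤ δ) :
    ENNReal.ofReal (1 - δ) ≤ μ {x | ∀ k ∈ F, x ∉ s k} := by
  have hcompl : {x | ∀ k ∈ F, x ∉ s k} = (⋃ k ∈ F, s k)ᶜ := by
    ext x
    simp
  rw [hcompl, ← ofReal_measureReal, probReal_compl_eq_one_sub (F.measurableSet_biUnion hs)]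
  gcongr
  exact (measureReal_biUnion_finset_le F s).trans hδ

variable {n D L : ℕ} [NeZero L] {w : ℕ → ℕ} (μ₁ μ₂ : Feat D) {σ : ℝ} (p q : ℝ) (hσ : 0 < σ)
  {g : Fin n → Feat D} {S : Finset (Fin n)}

include hσ

theorem measureReal_le_expLoss_sub_empLoss_le (hS : S.Nonempty) (γ : ℝ) (θ : Params D L w)
    {t : ℝ} (ht : 0 ≤ t) :
    (labelLaw μ₁ μ₂ σ p q g S).real
        {y | t ≤ expLoss μ₁ μ₂ σ p q g S γ θ - empLoss g S γ θ y} ≤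
      Real.exp (-(2 * S.card * t ^ 2)) := by
  have hprob := isProbabilityMeasure_labelLaw μ₁ μ₂ p q hσ g S
  have := fun i : S => isProbabilityMeasure_labelDist μ₁ μ₂ p q hσ (g i)
  have hcard : (0 : ℝ) < S.card := by exact_mod_cast hS.card_pos
  have hdiff : ∀ y, expLoss μ₁ μ₂ σ p q g S γ θ - empLoss g S γ θ y = (S.card : ℝ)⁻¹ *
      ∑ i : S, (∫ k, marginLoss γ (logits θ (g i)) k ∂labelDist μ₁ μ₂ σ p q (g i) -
        marginLoss γ (logits θ (g i)) (y i)) := by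
    intro y
    simp only [expLoss, empLoss]
    rw [integral_const_mul, integral_finsetSum _ fun i _ => .of_finite, ← mul_sub,
      Finset.sum_sub_distrib]
    simp only [integral_labelLaw_eval μ₁ μ₂ p q hσ g S]
  have h := measureReal_le_sum_integral_sub_le
    (fun i : S => labelDist μ₁ μ₂ σ p q (g i)) (u := fun i => marginLoss γ (logits θ (g i)))
    (fun _ => measurable_of_finite _) (fun i => marginLoss_mem_Icc γ (logits θ (g i)))
    (mul_nonneg hcard.le ht)
  simp only [hdiff, le_inv_mul_iff₀ hcard]
  refine h.trans_eq ?_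
  rw [Fintype.card_coe]
  congr 2
  field_simp

theorem ofReal_one_sub_le_labelLaw_forall_expLoss_le (hS : S.Nonempty)
    {Θ : Set (Params D L w)} {F : Finset (Params D L w)} {η γ γ' t δ : ℝ}
    (hF : ∀ θ ∈ Θ, ∃ θ' ∈ F, ∀ i ∈ S, dist (logits θ (g i)) (logits θ' (g i)) ≤ η)
    (hγ : γ + 4 * η ≤ γ') (ht : 0 ≤ t) (hδ : 0 < δ)
    (htδ : Real.log F.card + Real.log (1 / δ) ≤ 2 * S.card * t ^ 2) :
    ENNReal.ofReal (1 - δ) ≤ labelLaw μ₁ μ₂ σ p q g S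
      {y | ∀ θ ∈ Θ, expLoss μ₁ μ₂ σ p q g S γ θ ≤ empLoss g S γ' θ y + t} := by
  have := isProbabilityMeasure_labelLaw μ₁ μ₂ p q hσ g S
  have hsum : ∑ θ ∈ F, (labelLaw μ₁ μ₂ σ p q g S).real {y | t ≤
      expLoss μ₁ μ₂ σ p q g S (γ + 2 * η) θ - empLoss g S (γ + 2 * η) θ y} ≤ δ := by
    refine (Finset.sum_le_card_nsmul _ _ _ fun θ _ =>
      measureReal_le_expLoss_sub_empLoss_le μ₁ μ₂ p q hσ hS (γ + 2 * η) θ ht).trans ?_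
    rcases F.eq_empty_or_nonempty with rfl | hne
    · simpa using hδ.le
    have hcard : (0 : ℝ) < F.card := by exact_mod_cast hne.card_pos
    calc F.card • Real.exp (-(2 * S.card * t ^ 2))
        ≤ F.card • Real.exp (-(Real.log F.card + Real.log (1 / δ))) := by gcongr
      _ = δ := by
        rw [neg_add, Real.exp_add, Real.exp_neg, Real.exp_log hcard, one_div, Real.log_inv,
          neg_neg, Real.exp_log hδ, nsmul_eq_mul, mul_inv_cancel_left₀ hcard.ne']
  refine (ofReal_one_sub_le_measure_forall_notMem (labelLaw μ₁ μ₂ σ p q g S)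
    (fun _ _ => (Set.toFinite _).measurableSet) hsum).trans (measure_mono fun y hy θ hθ => ?_)
  obtain ⟨θ', hθ'F, hclose⟩ := hF θ hθ
  have hdev := hy θ' hθ'F
  rw [Set.mem_ofPred_eq, not_le] at hdev
  have hexp : expLoss μ₁ μ₂ σ p q g S γ θ ≤ expLoss μ₁ μ₂ σ p q g S (γ + 2 * η) θ' :=
    expLoss_mono μ₁ μ₂ p q hσ hclose le_rfl
  have hemp : empLoss g S (γ + 2 * η) θ' y ≤ empLoss g S γ' θ y :=
    empLoss_mono (fun i hi => (dist_comm _ _).trans_le (hclose i hi)) (by linarith) y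
  linarith

end Concentration

/-! ### The Gaussian prior -/

section Prior

theorem ofReal_exp_le_gaussianReal_ball {v : ℝ≥0} (hv : v ≠ 0) {a r R : ℝ} (hr : 0 < r)
    (hvr : 2 * Real.pi * v ≤ (2 * r) ^ 2) (hR : |a| + r ≤ R) :
    ENNReal.ofReal (Real.exp (-(R ^ 2 / (2 * v)))) ≤ gaussianReal 0 v (Metric.ball a r) := by
  have hpdf : ∀ x ∈ Metric.ball a r, ENNReal.ofReal
      ((√(2 * Real.pi * v))⁻¹ * Real.exp (-(R ^ 2 / (2 * v)))) ≤ gaussianPDF 0 v x := by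
    intro x hx
    have hxR : |x| ≤ R := by
      rw [Metric.mem_ball, Real.dist_eq] at hx
      linarith [abs_sub_abs_le_abs_sub x a]
    have hsq : x ^ 2 ≤ R ^ 2 := sq_le_sq.2 (hxR.trans (le_abs_self R))
    rw [gaussianPDF, gaussianPDFReal, sub_zero, neg_div]
    gcongr ENNReal.ofReal (_ * Real.exp (-(?_ / _)))
  have hheight : 1 ≤ (√(2 * Real.pi * v))⁻¹ * (2 * r) := by
    rw [inv_mul_eq_div, one_le_div (by positivity)]
    exact Real.sqrt_le_iff.2 ⟨by positivity, hvr⟩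
  rw [gaussianReal_apply 0 hv]
  calc ENNReal.ofReal (Real.exp (-(R ^ 2 / (2 * v))))
      ≤ ENNReal.ofReal ((√(2 * Real.pi * v))⁻¹ * Real.exp (-(R ^ 2 / (2 * v)))) *
          volume (Metric.ball a r) := by
        rw [Real.volume_ball, ← ENNReal.ofReal_mul (by positivity), mul_right_comm]
        exact ENNReal.ofReal_le_ofReal (le_mul_of_one_le_left (Real.exp_pos _).le hheight)
    _ = ∫⁻ _ in Metric.ball a r, ENNReal.ofReal
          ((√(2 * Real.pi * v))⁻¹ * Real.exp (-(R ^ 2 / (2 * v)))) :=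
        (setLIntegral_const _ _).symm
    _ ≤ ∫⁻ x in Metric.ball a r, gaussianPDF 0 v x :=
        setLIntegral_mono' Metric.isOpen_ball.measurableSet hpdf

theorem ofReal_exp_le_pi_gaussianReal_ball {ι : Type*} [Fintype ι] {v : ℝ≥0} (hv : v ≠ 0)
    {θ : ι → ℝ} {r R : ℝ} (hr : 0 < r) (hvr : 2 * Real.pi * v ≤ (2 * r) ^ 2)
    (hR : ‖θ‖ + r ≤ R) :
    ENNReal.ofReal (Real.exp (-(Fintype.card ι * (R ^ 2 / (2 * v))))) ≤
      Measure.pi (fun _ : ι => gaussianReal 0 v) (Metric.ball θ r) := by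
  rw [ball_pi θ hr, Measure.pi_pi]
  calc ENNReal.ofReal (Real.exp (-(Fintype.card ι * (R ^ 2 / (2 * v)))))
      = ∏ _i : ι, ENNReal.ofReal (Real.exp (-(R ^ 2 / (2 * v)))) := by
        rw [Finset.prod_const, Finset.card_univ, ← ENNReal.ofReal_pow (Real.exp_pos _).le,
          ← Real.exp_nat_mul, mul_neg]
    _ ≤ ∏ i : ι, gaussianReal 0 v (Metric.ball (θ i) r) := Finset.prod_le_prod' fun i _ =>
        ofReal_exp_le_gaussianReal_ball hv hr hvr
          ((add_le_add_left (norm_le_pi_norm θ i) r).trans hR)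

theorem measure_inter_le_cond {Ω : Type*} [MeasurableSpace Ω] (μ : Measure Ω)
    [IsProbabilityMeasure μ] (s t : Set Ω) : μ (t ∩ s) ≤ μ[t | s] := by
  rw [ProbabilityTheory.cond, Measure.smul_apply, smul_eq_mul]
  refine (Measure.le_restrict_apply s t).trans (le_mul_of_one_le_left zero_le ?_)
  exact ENNReal.one_le_inv.2 prob_le_one

theorem exists_mem_of_concentratedLossDiff {n D L : ℕ} [NeZero L] {w : ℕ → ℕ} {b : ℕ}
    {μ₁ μ₂ : Feat D} {σ c γ α : ℝ} {g : Fin n → Feat D} {V₀ V : Finset (Fin n)} {p₀ q₀ p q : ℝ}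
    (hconc : ConcentratedLossDiff L w b μ₁ μ₂ σ c γ α g V₀ V p₀ q₀ p q)
    {s : Set (Params D L w)}
    (hs : ENNReal.ofReal (Real.exp (-(V₀.card : ℝ) ^ (2 * α))) <
      prior D L w (priorVar L b γ (featDist g V₀ V) α V₀.card) s) :
    ∃ θ ∈ s, maxSpec θ ^ L * featDist g V₀ V ≤ γ / 8 ∨
      expLoss μ₁ μ₂ σ p q g V (γ / 4) θ - expLoss μ₁ μ₂ σ p₀ q₀ g V₀ (γ / 2) θ ≤
        (V₀.card : ℝ) ^ (-α) +
          c * shiftTerm μ₁ μ₂ σ (featDist g V₀ V) |homophily p₀ q₀ - homophily p q| := by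
  by_contra! hbad
  have : IsProbabilityMeasure (prior D L w (priorVar L b γ (featDist g V₀ V) α V₀.card)) := by
    rw [prior]
    infer_instance
  refine hs.not_ge (le_trans (measure_mono fun θ hθ => ?_)
    ((measure_inter_le_cond _ _ _).trans hconc))
  exact ⟨(hbad θ hθ).2, (hbad θ hθ).1⟩

theorem priorVar_eq {N : ℕ} (hN : 0 < N) (L b : ℕ) (γ ε α : ℝ) :
    priorVar L b γ ε α N =
      (γ / (8 * ε)) ^ (2 / (L : ℝ)) / (2 * b * ((N : ℝ) ^ α + Real.log (2 * b * L))) := by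
  have hN' : (0 : ℝ) < N := by exact_mod_cast hN
  rw [priorVar, ← Real.rpow_add hN', show 2 * α + -α = α by ring]

variable {L b N : ℕ} {γ ε α : ℝ}

theorem log_two_mul_mul_nonneg (b L : ℕ) : 0 ≤ Real.log (2 * b * L) := by
  exact_mod_cast Real.log_natCast_nonneg (2 * b * L)

theorem priorVar_pos (L : ℕ) (hb : 1 ≤ b) (hN : 0 < N) (hγ : 0 < γ) (hε : 0 < ε) (α : ℝ) :
    0 < priorVar L b γ ε α N := by
  have hlog := log_two_mul_mul_nonneg b L
  rw [priorVar_eq hN]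
  positivity

theorem priorVar_le (L : ℕ) (hb : 1 ≤ b) (hN : 0 < N) (hγ : 0 ≤ γ) {ε₀ : ℝ} (hε₀ : 0 < ε₀)
    (hε : ε₀ ≤ ε) (α : ℝ) :
    priorVar L b γ ε α N ≤ (γ / (8 * ε₀)) ^ (2 / (L : ℝ)) / (2 * (N : ℝ) ^ α) := by
  have hε' : 0 < ε := hε₀.trans_le hε
  have hlog := log_two_mul_mul_nonneg b L
  have hb' : (1 : ℝ) ≤ b := by exact_mod_cast hb
  rw [priorVar_eq hN]
  gcongr
  · linarith
  · linarith

theorem one_div_two_mul_priorVar_le (L : ℕ) (hb : 1 ≤ b) (hN : 0 < N) (hγ : 0 < γ) (hε : 0 < ε)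
    {E : ℝ} (hεE : ε ≤ E) (α : ℝ) :
    1 / (2 * priorVar L b γ ε α N) ≤
      b / (γ / (8 * E)) ^ (2 / (L : ℝ)) * ((N : ℝ) ^ α + Real.log (2 * b * L)) := by
  have hE : 0 < E := hε.trans_le hεE
  have hlog := log_two_mul_mul_nonneg b L
  calc 1 / (2 * priorVar L b γ ε α N)
      = b / (γ / (8 * ε)) ^ (2 / (L : ℝ)) * ((N : ℝ) ^ α + Real.log (2 * b * L)) := by
        rw [priorVar_eq hN]
        field_simp
    _ ≤ _ := by gcongr

theorem eventually_mul_add_lt_sq {K a : ℝ} (hK : 0 ≤ K) (ha : 0 ≤ a) :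
    ∀ᶠ u : ℝ in Filter.atTop, K * (u + a) < u ^ 2 := by
  filter_upwards [Filter.eventually_ge_atTop 1, Filter.eventually_gt_atTop (K * (1 + a))]
    with u hu1 hu
  calc K * (u + a) ≤ K * (1 + a) * u := by
        have := mul_le_mul_of_nonneg_left (le_mul_of_one_le_right ha hu1) hK
        linarith
    _ < u * u := by gcongr
    _ = u ^ 2 := (sq u).symm

theorem tendsto_natCast_rpow_atTop (hα : 0 < α) :
    Filter.Tendsto (fun N : ℕ => (N : ℝ) ^ α) Filter.atTop Filter.atTop :=
  (tendsto_rpow_atTop hα).comp tendsto_natCast_atTop_atTop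

theorem eventually_two_pi_mul_priorVar_le (L : ℕ) (hb : 1 ≤ b) (hγ : 0 < γ) (hα : 0 < α)
    {ε₀ a : ℝ} (hε₀ : 0 < ε₀) (ha : 0 < a) :
    ∀ᶠ N : ℕ in Filter.atTop, ∀ ε, ε₀ ≤ ε → 2 * Real.pi * priorVar L b γ ε α N ≤ a := by
  filter_upwards [Filter.eventually_gt_atTop 0, (tendsto_natCast_rpow_atTop hα).eventually_ge_atTop
    (Real.pi * (γ / (8 * ε₀)) ^ (2 / (L : ℝ)) / a)] with N hN hwidth ε hε
  calc 2 * Real.pi * priorVar L b γ ε α N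
      ≤ 2 * Real.pi * ((γ / (8 * ε₀)) ^ (2 / (L : ℝ)) / (2 * (N : ℝ) ^ α)) := by
        gcongr
        exact priorVar_le L hb hN hγ.le hε₀ hε α
    _ = Real.pi * (γ / (8 * ε₀)) ^ (2 / (L : ℝ)) / (N : ℝ) ^ α := by field_simp
    _ ≤ a := (div_le_comm₀ ha (by positivity)).1 hwidth

theorem eventually_lt_prior_ball (D L : ℕ) (w : ℕ → ℕ) (hb : 1 ≤ b) (hγ : 0 < γ) (hα : 0 < α)
    {ε₀ r : ℝ} (hε₀ : 0 < ε₀) (hr : 0 < r) (E C : ℝ) :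
    ∀ᶠ N : ℕ in Filter.atTop, ∀ ε ∈ Set.Icc ε₀ E, ∀ θ : Params D L w, ‖θ‖ ≤ C →
      ENNReal.ofReal (Real.exp (-(N : ℝ) ^ (2 * α))) <
        prior D L w (priorVar L b γ ε α N) (Metric.ball θ r) := by
  rcases lt_or_ge E ε₀ with hE | hE
  · exact .of_forall fun N ε hε => absurd (hε.1.trans hε.2) hE.not_ge
  set d := Fintype.card (Σ l : Fin L, Fin (width D L w (l + 1)) × Fin (width D L w l))
  set κ := b / (γ / (8 * E)) ^ (2 / (L : ℝ))
  have hκ : 0 ≤ κ := by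
    have hE0 : 0 < E := hε₀.trans_le hE
    positivity
  filter_upwards [Filter.eventually_gt_atTop 0,
    (tendsto_natCast_rpow_atTop hα).eventually (eventually_mul_add_lt_sq
      (K := d * (C + r) ^ 2 * κ) (by positivity) (log_two_mul_mul_nonneg b L)),
    eventually_two_pi_mul_priorVar_le L hb hγ hα hε₀ (a := (2 * r) ^ 2) (by positivity)]
    with N hN hquad hvr ε hε θ hθ
  have hε' : 0 < ε := hε₀.trans_le hε.1
  have hv := priorVar_pos L hb hN hγ hε' α
  have hcoe : ((priorVar L b γ ε α N).toNNReal : ℝ) = priorVar L b γ ε α N :=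
    Real.coe_toNNReal _ hv.le
  refine lt_of_lt_of_le ?_ (ofReal_exp_le_pi_gaussianReal_ball (R := C + r)
    (Real.toNNReal_pos.2 hv).ne' hr (by rw [hcoe]; exact hvr ε hε.1) (by linarith))
  rw [ENNReal.ofReal_lt_ofReal_iff (Real.exp_pos _), Real.exp_lt_exp, neg_lt_neg_iff, hcoe]
  calc (d : ℝ) * ((C + r) ^ 2 / (2 * priorVar L b γ ε α N))
      = d * (C + r) ^ 2 * (1 / (2 * priorVar L b γ ε α N)) := by ring
    _ ≤ d * (C + r) ^ 2 * (κ * ((N : ℝ) ^ α + Real.log (2 * b * L))) := by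
      gcongr
      exact one_div_two_mul_priorVar_le L hb hN hγ hε' hε.2 α
    _ = d * (C + r) ^ 2 * κ * ((N : ℝ) ^ α + Real.log (2 * b * L)) := by ring
    _ < ((N : ℝ) ^ α) ^ 2 := hquad
    _ = (N : ℝ) ^ (2 * α) := by
      rw [mul_comm, ← Nat.cast_two (R := ℝ), Real.rpow_mul_natCast N.cast_nonneg]

end Prior

/-! ### The terms of the bound -/

section Terms

variable {D L b N : ℕ} {w : ℕ → ℕ} {γ α : ℝ}

theorem normTerm_nonneg {ε : ℝ} (hγ : 0 ≤ γ) (hε : 0 ≤ ε) (b : ℕ) (α : ℝ) (N : ℕ)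
    (θ : Params D L w) : 0 ≤ normTerm b γ α ε N θ := by
  have hsum := sum_frobSq_nonneg θ
  rw [normTerm]
  positivity

theorem mul_rpow_neg_le_normTerm [NeZero L] {ε s : ℝ} (hb : 1 ≤ b) (hγ : 0 < γ) (hε : 0 ≤ ε)
    (hs : 0 ≤ s) {θ : Params D L w} (hθ : s * (γ / 8) ≤ maxSpec θ ^ L * ε) (α : ℝ) (N : ℕ) :
    s ^ (2 / (L : ℝ)) * (N : ℝ) ^ (-α) ≤ normTerm b γ α ε N θ := by
  have hL : (L : ℝ) ≠ 0 := by exact_mod_cast NeZero.ne L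
  have hb' : (1 : ℝ) ≤ b := by exact_mod_cast hb
  have hT := maxSpec_nonneg θ
  have hsum := sum_frobSq_nonneg θ
  have hpow : (maxSpec θ ^ L) ^ (2 / (L : ℝ)) ≤ b * ∑ l : Fin L, frobSq (weight θ l) := by
    rw [← Real.rpow_natCast, ← Real.rpow_mul hT, mul_div_cancel₀ _ hL, Real.rpow_two]
    exact (maxSpec_sq_le_sum_frobSq θ).trans (le_mul_of_one_le_left hsum hb')
  calc s ^ (2 / (L : ℝ)) * (N : ℝ) ^ (-α)
      ≤ (maxSpec θ ^ L * ε / (γ / 8)) ^ (2 / (L : ℝ)) * (N : ℝ) ^ (-α) := by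
        gcongr
        rwa [le_div_iff₀ (by positivity)]
    _ = (maxSpec θ ^ L) ^ (2 / (L : ℝ)) / ((γ / 8) ^ (2 / (L : ℝ)) * (N : ℝ) ^ α) *
          ε ^ (2 / (L : ℝ)) := by
        rw [Real.div_rpow (by positivity) (by positivity), Real.mul_rpow (by positivity) hε,
          Real.rpow_neg N.cast_nonneg]
        field_simp
    _ ≤ normTerm b γ α ε N θ := by
        rw [normTerm]
        gcongr

theorem log_one_div_le_log_max_div (a : ℝ) {δ : ℝ} (hδ : 0 < δ) :
    Real.log (1 / δ) ≤ Real.log (max 1 a / δ) := by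
  gcongr
  exact le_max_left _ _

theorem log_max_div_nonneg (a : ℝ) {δ : ℝ} (hδ : 0 < δ) (hδ1 : δ ≤ 1) :
    0 ≤ Real.log (max 1 a / δ) :=
  (Real.log_nonneg ((one_le_div hδ).2 hδ1)).trans (log_one_div_le_log_max_div a hδ)

theorem remainder_nonneg (L : ℕ) (γ α C B : ℝ) {δ : ℝ} (hδ : 0 < δ) (hδ1 : δ ≤ 1) (N : ℕ) :
    0 ≤ remainder L γ α C B δ N := by
  have hlog := log_max_div_nonneg (L * C * (2 * B) ^ (1 / (L : ℝ)) / γ ^ (1 / (L : ℝ))) hδ hδ1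
  rw [remainder]
  positivity

theorem add_log_one_div_le_two_mul_sq (hN : 0 < N) {δ τ Λ : ℝ} (hδ : 0 < δ) (hδ1 : δ ≤ 1)
    (hΛ : Λ ≤ 8 * (τ * (N : ℝ) ^ α)) (L : ℕ) (γ C B : ℝ) :
    Λ + Real.log (1 / δ) ≤
      2 * N * (remainder L γ α C B δ N + τ * (N : ℝ) ^ (-α)) ^ 2 := by
  have hN' : (0 : ℝ) < N := by exact_mod_cast hN
  set a := L * C * (2 * B) ^ (1 / (L : ℝ)) / γ ^ (1 / (L : ℝ)) with ha
  set ℓ := Real.log (max 1 a / δ) with hℓ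
  have hℓ0 : 0 ≤ ℓ := log_max_div_nonneg a hδ hδ1
  have hδℓ : Real.log (1 / δ) ≤ ℓ := log_one_div_le_log_max_div a hδ
  set x := 1 / (N : ℝ) ^ (1 - 2 * α) with hx
  set s := 1 / (N : ℝ) ^ (2 * α) * ℓ + τ * (N : ℝ) ^ (-α) with hs
  have hNx : N * x = (N : ℝ) ^ (2 * α) := by
    rw [hx, mul_one_div, div_eq_iff (by positivity), ← Real.rpow_add hN', add_sub_cancel,
      Real.rpow_one]
  have hNxs : N * x * s = ℓ + τ * (N : ℝ) ^ α := by
    rw [hNx, hs, mul_add, ← mul_assoc, mul_one_div_cancel (by positivity), one_mul,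
      mul_left_comm, ← Real.rpow_add hN', show 2 * α + -α = α by ring]
  -- AM-GM: of the square only the cross terms of its first summand `x` with the others are
  -- needed, since `N * x = N ^ (2 * α)` cancels the decay of both.
  calc Λ + Real.log (1 / δ) ≤ 8 * (N * x * s) := by linarith
    _ = 2 * N * (4 * x * s) := by ring
    _ ≤ 2 * N * (x + s) ^ 2 := by
        gcongr
        exact four_mul_le_sq_add x s
    _ = _ := by rw [remainder, ← ha, ← hℓ, ← hx, add_assoc]

theorem empLoss_eq_one_or_mul_rpow_neg_le_normTerm [NeZero L] {n : ℕ} {g : Fin n → Feat D}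
    {S : Finset (Fin n)} (hS : S.Nonempty) {B : ℝ} (hB0 : 0 < B) (hB : ∀ i ∈ S, ‖g i‖ ≤ B)
    (hb : 1 ≤ b) (hγ : 0 < γ) {ε₀ ε : ℝ} (hε₀ : 0 ≤ ε₀) (hε : ε₀ ≤ ε) (α : ℝ) (N : ℕ)
    (θ : Params D L w) (y : S → Label) :
    empLoss g S γ θ y = 1 ∨
      (4 * ε₀ / B) ^ (2 / (L : ℝ)) * (N : ℝ) ^ (-α) ≤ normTerm b γ α ε N θ := by
  refine (empLoss_eq_one_or_le_maxSpec_pow hS hB0 hB γ θ y).imp_right fun hθ => ?_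
  refine mul_rpow_neg_le_normTerm hb hγ (hε₀.trans hε) (by positivity) ?_ α N
  calc 4 * ε₀ / B * (γ / 8) = γ / (2 * B) * ε₀ := by field_simp; ring
    _ ≤ maxSpec θ ^ L * ε :=
        mul_le_mul hθ hε hε₀ (pow_nonneg (maxSpec_nonneg θ) L)

end Terms

/-! ### From the training nodes to the test subgroup -/

section Generalization

variable {D L : ℕ} [NeZero L] {w : ℕ → ℕ} {b : ℕ} (μ₁ μ₂ : Feat D) {σ γ α : ℝ} (hσ : 0 < σ)

include hσ

theorem expLoss_le_expLoss_of_lt_prior {n : ℕ} {g : Fin n → Feat D} {V₀ V : Finset (Fin n)}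
    {c B p₀ q₀ p q : ℝ} (hp : 0 ≤ p) (hq : 0 ≤ q) (hpq : p + q ≠ 0) (hpq₀ : p₀ + q₀ ≠ 0)
    (hV₀ : V₀.Nonempty) (hB : ∀ i ∈ V₀, ‖g i‖ ≤ B) (hnear : EqualDisjointNearSets g V₀ V)
    (hconc : ConcentratedLossDiff L w b μ₁ μ₂ σ c γ α g V₀ V p₀ q₀ p q)
    {s : Set (Params D L w)}
    (hs : ENNReal.ofReal (Real.exp (-(V₀.card : ℝ) ^ (2 * α))) <
      prior D L w (priorVar L b γ (featDist g V₀ V) α V₀.card) s)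
    {θ : Params D L w} {γ₀ γ₁ η : ℝ}
    (hclose : ∀ θ' ∈ s, ∀ i, i ∈ V₀ ∨ i ∈ V → dist (logits θ (g i)) (logits θ' (g i)) ≤ η)
    (hγ₀ : γ₀ + 2 * η ≤ γ / 4) (hγ₁ : γ / 2 + 2 * η ≤ γ₁) :
    expLoss μ₁ μ₂ σ p q g V γ₀ θ ≤ expLoss μ₁ μ₂ σ p₀ q₀ g V₀ γ₁ θ + (V₀.card : ℝ) ^ (-α) +
      max c (shiftConst μ₁ μ₂ σ B) * shiftTerm μ₁ μ₂ σ (featDist g V₀ V)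
        |homophily p₀ q₀ - homophily p q| := by
  set Sh := shiftTerm μ₁ μ₂ σ (featDist g V₀ V) |homophily p₀ q₀ - homophily p q|
  have hSh : 0 ≤ Sh := shiftTerm_nonneg μ₁ μ₂ hσ (featDist_nonneg g) (abs_nonneg _)
  have hNα : 0 ≤ (V₀.card : ℝ) ^ (-α) := by positivity
  obtain ⟨θ', hθ's, hθ'⟩ := exists_mem_of_concentratedLossDiff hconc hs
  have htest : expLoss μ₁ μ₂ σ p q g V γ₀ θ ≤ expLoss μ₁ μ₂ σ p q g V (γ / 4) θ' :=
    expLoss_mono μ₁ μ₂ p q hσ (fun i hi => hclose θ' hθ's i (.inr hi)) hγ₀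
  have htrain : expLoss μ₁ μ₂ σ p₀ q₀ g V₀ (γ / 2) θ' ≤ expLoss μ₁ μ₂ σ p₀ q₀ g V₀ γ₁ θ :=
    expLoss_mono μ₁ μ₂ p₀ q₀ hσ
      (fun i hi => (dist_comm _ _).trans_le (hclose θ' hθ's i (.inl hi))) hγ₁
  have hcompare : expLoss μ₁ μ₂ σ p q g V (γ / 4) θ' ≤ expLoss μ₁ μ₂ σ p₀ q₀ g V₀ (γ / 2) θ' +
      (V₀.card : ℝ) ^ (-α) + max c (shiftConst μ₁ μ₂ σ B) * Sh := by
    rcases hθ' with hspec | hdiff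
    · have hlip := expLoss_le_expLoss_of_maxSpec (γ := γ / 4) (γ' := γ / 2) μ₁ μ₂ hσ hp hq hpq
        hpq₀ hV₀ hB hnear hspec (by linarith)
      linarith [mul_le_mul_of_nonneg_right (le_max_right c (shiftConst μ₁ μ₂ σ B)) hSh]
    · linarith [mul_le_mul_of_nonneg_right (le_max_left c (shiftConst μ₁ μ₂ σ B)) hSh]
  linarith

theorem eventually_forall_expLoss_le_add_normTerm (L : ℕ) [NeZero L] (w : ℕ → ℕ) (hb : 1 ≤ b)
    (hγ : 0 < γ) (hα : 0 < α) {ε₀ : ℝ} (hε₀ : 0 < ε₀) (B c C : ℝ) :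
    ∀ᶠ N : ℕ in Filter.atTop, ∀ (n : ℕ) (g : Fin n → Feat D) (V₀ V : Finset (Fin n))
      (p₀ q₀ p q : ℝ), p₀ + q₀ ≠ 0 → 0 ≤ p → 0 ≤ q → p + q ≠ 0 → V₀.card = N →
      maxNorm g V₀ V ≤ B → ε₀ ≤ featDist g V₀ V → EqualDisjointNearSets g V₀ V →
      ConcentratedLossDiff L w b μ₁ μ₂ σ c γ α g V₀ V p₀ q₀ p q →
      ∀ θ : Params D L w, ‖θ‖ ≤ C →
        expLoss μ₁ μ₂ σ p q g V 0 θ ≤ expLoss μ₁ μ₂ σ p₀ q₀ g V₀ (5 * γ / 8) θ +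
          normTerm b γ α (featDist g V₀ V) N θ +
          max c (shiftConst μ₁ μ₂ σ B) * shiftTerm μ₁ μ₂ σ (featDist g V₀ V)
            |homophily p₀ q₀ - homophily p q| := by
  obtain ⟨r, ⟨hr0, hr1⟩, hclose⟩ :=
    exists_forall_dist_logits_le D L w (C + 1) B (η := γ / 16) (by positivity)
  filter_upwards [Filter.eventually_gt_atTop 0,
    eventually_lt_prior_ball D L w hb hγ hα hε₀ hr0 (2 * B) C] with
    _ hN hmass n g V₀ V p₀ q₀ p q hpq₀ hp hq hpq rfl hB hε hnear hconc θ hθ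
  have hV₀ : V₀.Nonempty := Finset.card_pos.1 hN
  have hε0 : 0 ≤ featDist g V₀ V := featDist_nonneg g
  have hgB : ∀ i, i ∈ V₀ ∨ i ∈ V → ‖g i‖ ≤ B := fun i hi => (norm_le_maxNorm g hi).trans hB
  rcases le_or_gt (maxSpec θ ^ L * featDist g V₀ V) (γ / 8) with hspec | hspec
  · have hlip := expLoss_le_expLoss_of_maxSpec (γ := 0) (γ' := 5 * γ / 8) μ₁ μ₂ hσ hp hq hpq hpq₀
      hV₀ (fun i hi => hgB i (.inl hi)) hnear hspec (by linarith)
    have hSh := mul_le_mul_of_nonneg_right (le_max_right c (shiftConst μ₁ μ₂ σ B))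
      (shiftTerm_nonneg μ₁ μ₂ hσ hε0 (abs_nonneg (homophily p₀ q₀ - homophily p q)))
    linarith [normTerm_nonneg hγ.le hε0 b α V₀.card θ]
  · have hε2B : featDist g V₀ V ≤ 2 * B := (featDist_le_two_mul_maxNorm g hV₀).trans (by linarith)
    have hball : ∀ θ' ∈ Metric.ball θ r, ∀ i, i ∈ V₀ ∨ i ∈ V →
        dist (logits θ (g i)) (logits θ' (g i)) ≤ γ / 16 := by
      intro θ' hθ' i hi
      have hθ'C : ‖θ'‖ ≤ C + 1 := by
        linarith [norm_le_norm_add_norm_sub' θ' θ, (mem_ball_iff_norm.1 hθ').le]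
      exact hclose θ θ' (by linarith) hθ'C (Metric.mem_ball'.1 hθ') _ (hgB i hi)
    have htransfer := expLoss_le_expLoss_of_lt_prior (γ₀ := 0) (γ₁ := 5 * γ / 8) μ₁ μ₂ hσ hp hq
      hpq hpq₀ hV₀ (fun i hi => hgB i (.inl hi)) hnear hconc (hmass _ ⟨hε, hε2B⟩ θ hθ) hball
      (by linarith) (by linarith)
    have hnorm : (V₀.card : ℝ) ^ (-α) ≤ normTerm b γ α (featDist g V₀ V) V₀.card θ := by
      simpa using mul_rpow_neg_le_normTerm hb hγ hε0 zero_le_one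
        ((one_mul (γ / 8)).trans_le hspec.le) α V₀.card
    linarith

theorem eventually_ofReal_one_sub_le_labelLaw_forall_expLoss_le (L : ℕ) [NeZero L] (w : ℕ → ℕ)
    {γ' τ : ℝ} (hγ : γ < γ') (hα : 0 < α) (hτ : 0 < τ) (B C : ℝ) :
    ∀ᶠ N : ℕ in Filter.atTop, ∀ (n : ℕ) (g : Fin n → Feat D) (S : Finset (Fin n)) (p q : ℝ),
      S.card = N → (∀ i ∈ S, ‖g i‖ ≤ B) → ∀ γ₀ B₀ δ : ℝ, 0 < δ → δ ≤ 1 →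
        ENNReal.ofReal (1 - δ) ≤ labelLaw μ₁ μ₂ σ p q g S {y | ∀ θ : Params D L w, ‖θ‖ ≤ C →
          expLoss μ₁ μ₂ σ p q g S γ θ ≤ empLoss g S γ' θ y +
            (remainder L γ₀ α C B₀ δ N + τ * (N : ℝ) ^ (-α))} := by
  obtain ⟨F, hF⟩ := exists_finset_dist_logits_le D L w C B (η := (γ' - γ) / 4) (by linarith)
  filter_upwards [Filter.eventually_gt_atTop 0,
    (tendsto_natCast_rpow_atTop hα).eventually_ge_atTop (Real.log F.card / (8 * τ))] with
    _ hN hlarge n g S p q rfl hB γ₀ B₀ δ hδ hδ1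
  have hΛ : Real.log F.card ≤ 8 * (τ * (S.card : ℝ) ^ α) := by
    rw [← mul_assoc]
    exact (div_le_iff₀' (by positivity)).1 hlarge
  refine ofReal_one_sub_le_labelLaw_forall_expLoss_le μ₁ μ₂ p q hσ (Θ := {θ | ‖θ‖ ≤ C})
    (η := (γ' - γ) / 4) (Finset.card_pos.1 hN) (fun θ hθ => ?_) (by linarith)
    (add_nonneg (remainder_nonneg L γ₀ α C B₀ hδ hδ1 _) (by positivity)) hδ
    (add_log_one_div_le_two_mul_sq hN hδ hδ1 hΛ L γ₀ C B₀)
  obtain ⟨θ', hθ'F, hclose⟩ := hF θ hθ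
  exact ⟨θ', hθ'F, fun i hi => hclose _ (hB i hi)⟩

end Generalization

end SubgroupGNN

end

open SubgroupGNN in
theorem theorem1_general (D : ℕ) (μ₁ μ₂ : Feat D) (σ : ℝ) (hσ : 0 < σ) (B c : ℝ) :
    ∃ A : ℝ, 0 < A ∧
      ∀ (L : ℕ) [NeZero L] (w : ℕ → ℕ) (b : ℕ), 1 ≤ b →
      ∀ γ C α ε₀ : ℝ, 0 < γ → 0 < α → 0 < ε₀ →
      ∃ N₁ : ℕ, ∀ (n : ℕ) (g : Fin n → Feat D) (V₀ V : Finset (Fin n)) (p₀ q₀ p q : ℝ),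
        p₀ + q₀ ≠ 0 → 0 ≤ p → 0 ≤ q → p + q ≠ 0 →
        N₁ ≤ V₀.card → maxNorm g V₀ V ≤ B → ε₀ ≤ featDist g V₀ V →
        EqualDisjointNearSets g V₀ V →
        ConcentratedLossDiff L w b μ₁ μ₂ σ c γ α g V₀ V p₀ q₀ p q →
        ∀ δ : ℝ, 0 < δ → δ ≤ 1 →
          ENNReal.ofReal (1 - δ) ≤ labelLaw μ₁ μ₂ σ p₀ q₀ g V₀
            {y | ∀ θ : Params D L w, (∀ l, √(frobSq (weight θ l)) ≤ C) →
              expLoss μ₁ μ₂ σ p q g V 0 θ ≤ empLoss g V₀ γ θ y +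
                A * (shiftTerm μ₁ μ₂ σ (featDist g V₀ V) |homophily p₀ q₀ - homophily p q| +
                  normTerm b γ α (featDist g V₀ V) V₀.card θ +
                  remainder L γ α C (maxNorm g V₀ V) δ V₀.card)} := by
  have hA₀ : 0 ≤ max c (shiftConst μ₁ μ₂ σ B) :=
    (shiftConst_nonneg μ₁ μ₂ hσ B).trans (le_max_right _ _)
  refine ⟨max c (shiftConst μ₁ μ₂ σ B) + 2, by positivity, fun L _ w b hb γ C α ε₀ hγ hα hε₀ => ?_⟩
  have hB₁ : 0 < max B 1 := lt_max_of_lt_right one_pos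
  obtain ⟨N₁, hN₁⟩ := Filter.eventually_atTop.1 ((Filter.eventually_gt_atTop 0).and
    ((eventually_forall_expLoss_le_add_normTerm μ₁ μ₂ hσ L w hb hγ hα hε₀ B c C).and
    (eventually_ofReal_one_sub_le_labelLaw_forall_expLoss_le μ₁ μ₂ hσ L w (γ := 5 * γ / 8)
      (γ' := γ) (τ := (4 * ε₀ / max B 1) ^ (2 / (L : ℝ))) (by linarith) hα (by positivity) B C)))
  refine ⟨N₁, fun n g V₀ V p₀ q₀ p q hpq₀ hp hq hpq hN hB hε hnear hconc δ hδ hδ1 => ?_⟩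
  obtain ⟨hpos, htransfer, hdeviation⟩ := hN₁ _ hN
  have hgB : ∀ i ∈ V₀, ‖g i‖ ≤ B := fun i hi => (norm_le_maxNorm g (.inl hi)).trans hB
  refine (hdeviation n g V₀ p₀ q₀ rfl hgB γ (maxNorm g V₀ V) δ hδ hδ1).trans
    (measure_mono fun y hdev θ hθC => ?_)
  have hθ : ‖θ‖ ≤ C := norm_le_of_sqrt_frobSq_le hθC
  have hSh := shiftTerm_nonneg μ₁ μ₂ hσ (featDist_nonneg g)
    (abs_nonneg (homophily p₀ q₀ - homophily p q)) (ε := featDist g V₀ V)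
  have hT := normTerm_nonneg hγ.le (hε₀.le.trans hε) b α V₀.card θ
  have hR := remainder_nonneg L γ α C (maxNorm g V₀ V) hδ hδ1 V₀.card
  rcases empLoss_eq_one_or_mul_rpow_neg_le_normTerm (Finset.card_pos.1 hpos) hB₁
    (fun i hi => (hgB i hi).trans (le_max_left B 1)) hb hγ hε₀.le hε α V₀.card θ y with hone | hnorm
  · exact le_add_of_le_of_nonneg ((expLoss_le_one μ₁ μ₂ p q hσ g V 0 θ).trans_eq hone.symm)
      (by positivity)
  · nlinarith [htransfer n g V₀ V p₀ q₀ p q hpq₀ hp hq hpq rfl hB hε hnear hconc θ hθ,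
      hdev θ hθ, mul_nonneg hA₀ hT, mul_nonneg hA₀ hR]

open SubgroupGNN in
/-- The constant `A` depends only on the class means, `σ`, the bound `B` on the aggregated features
and the constant `c`. "Large enough" for the number of training nodes depends in addition on the
architecture, `γ`, `C`, `α` and a lower bound `ε₀` of the feature distance. -/
theorem theorem1 (D : ℕ) (μ₁ μ₂ : Feat D) (σ : ℝ) (hσ : 0 < σ) (B : ℝ) (c : ℝ) (hc : 0 ≤ c) :
    ∃ A : ℝ, 0 < A ∧
      ∀ (L : ℕ) [NeZero L] (w : ℕ → ℕ) (b : ℕ), 1 ≤ b → (∀ l, 0 < l → l < L → w l ≤ b) →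
      ∀ γ C α ε₀ : ℝ, 0 < γ → 0 < C → 0 < α → α < 1 / 4 → 0 < ε₀ →
      ∃ N₁ : ℕ, ∀ (n : ℕ) (G : SimpleGraph (Fin n)) (X : Fin n → Feat D)
        (M : ℕ) (V : Fin (M + 1) → Finset (Fin n)) (p q : Fin (M + 1) → ℝ),
        IsGeneralizedCSBMS p q →
        ∀ m : Fin (M + 1), m ≠ 0 →
        N₁ ≤ (V 0).card →
        maxNorm (aggregate G X) (V 0) (V m) ≤ B →
        ε₀ ≤ featDist (aggregate G X) (V 0) (V m) →
        EqualDisjointNearSets (aggregate G X) (V 0) (V m) →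
        ConcentratedLossDiff L w b μ₁ μ₂ σ c γ α (aggregate G X) (V 0) (V m)
          (p 0) (q 0) (p m) (q m) →
        ∀ δ : ℝ, 0 < δ → δ < 1 →
          ENNReal.ofReal (1 - δ) ≤
            labelLaw μ₁ μ₂ σ (p 0) (q 0) (aggregate G X) (V 0)
              {y | ∀ θ : Params D L w, (∀ l, Real.sqrt (frobSq (weight θ l)) ≤ C) →
                expLoss μ₁ μ₂ σ (p m) (q m) (aggregate G X) (V m) 0 θ ≤
                  empLoss (aggregate G X) (V 0) γ θ y +
                    A * (shiftTerm μ₁ μ₂ σ (featDist (aggregate G X) (V 0) (V m))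
                          |homophily (p 0) (q 0) - homophily (p m) (q m)| +
                        normTerm b γ α (featDist (aggregate G X) (V 0) (V m)) (V 0).card θ +
                        remainder L γ α C (maxNorm (aggregate G X) (V 0) (V m)) δ
                          (V 0).card)} := by
  obtain ⟨A, hA, h⟩ := theorem1_general D μ₁ μ₂ σ hσ B c
  refine ⟨A, hA, fun L _ w b hb _ γ C α ε₀ hγ _ hα _ hε₀ => ?_⟩
  obtain ⟨N₁, hN₁⟩ := h L w b hb γ C α ε₀ hγ hα hε₀
  exact ⟨N₁, fun n G X M V p q hpq m _ hN hB hε hnear hconc δ hδ hδ1 =>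
    hN₁ n (aggregate G X) (V 0) (V m) (p 0) (q 0) (p m) (q m) (hpq.pos 0).ne' (hpq.p_mem m).1
      (hpq.q_mem m).1 (hpq.pos m).ne' hN hB hε hnear hconc δ hδ hδ1.le⟩
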